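/- Let $m,n\in\mathbb N$, let $A_0,B_l\in M_n(\mathbb C)$ and $d_l\in\mathbb C^n$ for $0\le |l|\le m$, and consider, for a large real parameter $\omega$, the system $$\frac{dx}{dt}=\Bigl(A_0+\frac1\omega B_0\Bigr)x+\sum_{1\le |l|\le m}(B_lx+d_l)e^{il\omega t}+d_0. \qquad (1)$$ Assume that $0$ is an eigenvalue of $A_0$ and, with $A_1=B_0+\sum_{1\le|l|\le m}\frac{B_{-l}B_l}{il}$, that no eigenvector of $A_0$ with eigenvalue $0$ has an associated vector with respect to $A_0,A_1$: for every $a\ne0$ with $A_0a=0$ the equation $A_0x+A_1a=0$ has no solution $x\in\mathbb C^n$. Then for all sufficiently large $\omega$ system (1) has a unique $\frac{2\pi}{\omega}$-periodic solution $x(t)$. Assume moreover that the coefficient of $x$ in (1) is real, i.e. $A_0,B_0$ are real and $B_{-l}=\overline{B_l}$ for $1\le l\le m$. Apply to the homogeneous system $\frac{dx}{dt}=\bigl(A_0+\omega^{-1}B_0+\sum_{1\le|l|\le m}B_le^{il\omega t}\bigr)x$ the infinite sequence of Krylov–Bogoliubov changes of variables: for $k=0,1,2,\dots$, if the current formal system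 is $\frac{dy}{dt}=\bigl(\sum_{q\ge0}\omega^{-q}S_q(\omega t)\bigr)y$ with $2\pi$-periodic $S_q$, substitute $y=(I+\omega^{-k-1}U_k(\omega t))z$, where $U_k$ is the $2\pi$-periodic function of zero mean with $U_k'=S_k-\langle S_k\rangle$. (The first of these is $x=y+\sum_{1\le|l|\le m}\frac1{il\omega}B_l\,y\,e^{il\omega t}$.) In the limit this produces a formal system with constant coefficients $$\frac{dy}{dt}=A_\omega y,\qquad A_\omega=A_0+\omega^{-1}A_1+\omega^{-2}A_2+\cdots .$$ Let $|\lambda E-A_\omega|=\lambda^n+\alpha_1\lambda^{n-1}+\dots+\alpha_n$, where the $\alpha_s$ are formal power series in $\omega^{-1}$, put $\alpha_0=1$ and $\alpha_s=0$ for $s<0$ or $s>n$, and let $D_{j\omega}=\sum_{q\ge0}\omega^{-q}d_{jq}$ ($j=1,\dots,n$) be the leading principal $j\times j$ minor of the Hurwitz matrix $\Gamma(\omega)=(\alpha_{2i-k})_{i,k=1}^n$. Assume that none of the formal series $D_{1\omega},\dots,D_{n\omega}$ is identically zero, and let $d_{jq_j}$ be the first nonzero coefficient of $D_{j\omega}$.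 **Theorem 2.** If all the numbers $d_{jq_j}$ $(j=1,\dots,n)$ are positive, then for all sufficiently large $\omega$ the $\frac{2\pi}\omega$-periodic solution $x(t)$ of (1) is Lyapunov stable. If at least one of the numbers $d_{jq_j}$ is negative, then for all sufficiently large $\omega$ the solution $x(t)$ is unstable (not Lyapunov stable). -/

import Mathlib

open Filter
open scoped Matrix ComplexOrder

noncomputable section

namespace HighFreq

/-- The nonzero harmonics `1 ≤ |l| ≤ m`. -/
def harmonics (m : ℕ) : Finset ℤ := (Finset.Icc (-(m : ℤ)) (m : ℤ)).erase 0

/-- The right-hand side of the system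
`dx/dt = (A₀ + ω⁻¹ B₀) x + ∑_{1 ≤ |l| ≤ m} (B_l x + d_l) e^{i l ω t} + d₀`. -/
def rhs {n : ℕ} (m : ℕ) (A₀ : Matrix (Fin n) (Fin n) ℂ)
    (B : ℤ → Matrix (Fin n) (Fin n) ℂ) (d : ℤ → Fin n → ℂ) (ω : ℝ)
    (t : ℝ) (x : Fin n → ℂ) : Fin n → ℂ :=
  (A₀ + (ω : ℂ)⁻¹ • B 0) *ᵥ x
    + ∑ l ∈ harmonics m, Complex.exp (Complex.I * l * ω * t) • (B l *ᵥ x + d l) + d 0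

/-- `x : ℝ → ℂⁿ` is a `2π/ω`-periodic solution of the system on the whole axis. -/
def IsPeriodicSolution {n : ℕ} (m : ℕ) (A₀ : Matrix (Fin n) (Fin n) ℂ)
    (B : ℤ → Matrix (Fin n) (Fin n) ℂ) (d : ℤ → Fin n → ℂ) (ω : ℝ)
    (x : ℝ → Fin n → ℂ) : Prop :=
  IsIntegralCurve x (rhs m A₀ B d ω) ∧ Function.Periodic x (2 * Real.pi / ω)

/-- Lyapunov stability (for increasing time) of a solution `x` of `x' = v(t, x)`. -/
def IsLyapunovStable {E : Type*} [NormedAddCommGroup E] [NormedSpace ℝ E]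
    (v : ℝ → E → E) (x : ℝ → E) : Prop :=
  ∀ t₀ : ℝ, ∀ ε > 0, ∃ δ > 0, ∀ z : ℝ → E, IsIntegralCurveOn z v (Set.Ici t₀) →
    ‖z t₀ - x t₀‖ < δ → ∀ t ≥ t₀, ‖z t - x t‖ < ε

/-- The matrix `A₁ = B₀ + ∑_{1 ≤ |l| ≤ m} B_{-l} B_l / (i l)`. -/
def matA₁ {n : ℕ} (m : ℕ) (B : ℤ → Matrix (Fin n) (Fin n) ℂ) : Matrix (Fin n) (Fin n) ℂ :=
  B 0 + ∑ l ∈ harmonics m, (Complex.I * l)⁻¹ • (B (-l) * B l)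

/-! ### The Krylov–Bogoliubov averaging procedure

With `ε = ω⁻¹` and `τ = ω t`, a formal linear system `dy/dt = S(ε, τ) y` has as right-hand side a
formal power series in `ε` whose coefficients are matrix-valued trigonometric polynomials in `τ`.
The latter are represented as Laurent polynomials in `e^{iτ}` with matrix coefficients. -/

/-- Matrix-valued trigonometric polynomials: the coefficient with index `l` is the coefficient
of `e^{i l τ}`. -/
abbrev TrigPoly (n : ℕ) := LaurentPolynomial (Matrix (Fin n) (Fin n) ℂ)

/-- The mean value over a period. -/
def meanValue {n : ℕ} (V : TrigPoly n) : Matrix (Fin n) (Fin n) ℂ := V.coeff 0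

/-- The part of `V` with zero mean. -/
def oscPart {n : ℕ} (V : TrigPoly n) : TrigPoly n := V - LaurentPolynomial.C (meanValue V)

/-- The zero-mean antiderivative (in `τ`) of the zero-mean part of `V`. -/
def zeroMeanPrimitive {n : ℕ} (V : TrigPoly n) : TrigPoly n :=
  ∑ l ∈ V.coeff.support.erase 0,
    LaurentPolynomial.C ((Complex.I * l)⁻¹ • V.coeff l) * LaurentPolynomial.T l

/-- The right-hand side of the homogeneous system `dx/dt = (A₀ + ω⁻¹ B₀ + ∑ B_l e^{i l ω t}) x`. -/
def initialSystem {n : ℕ} (m : ℕ) (A₀ : Matrix (Fin n) (Fin n) ℂ)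
    (B : ℤ → Matrix (Fin n) (Fin n) ℂ) : PowerSeries (TrigPoly n) :=
  PowerSeries.monomial 0 (LaurentPolynomial.C A₀
      + ∑ l ∈ harmonics m, LaurentPolynomial.C (B l) * LaurentPolynomial.T l)
    + PowerSeries.monomial 1 (LaurentPolynomial.C (B 0))

/-- One Krylov–Bogoliubov change of variables. In `dy/dt = S y` put `y = P z`,
`P = I + ε^{k+1} U`, where `U` is the zero-mean function with `dU/dτ = V` and `V` is the
oscillating part of the coefficient of `ε^k` in `S`. Since `dP/dt = ω ε^{k+1} V = ε^k V`, the new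
system is `dz/dt = P⁻¹ (S P - ε^k V) z`. -/
def kbStep {n : ℕ} (k : ℕ) (S : PowerSeries (TrigPoly n)) : PowerSeries (TrigPoly n) :=
  let P : PowerSeries (TrigPoly n) :=
    1 + PowerSeries.monomial (k + 1) (zeroMeanPrimitive (PowerSeries.coeff k S))
  PowerSeries.invOfUnit P 1 *
    (S * P - PowerSeries.monomial k (oscPart (PowerSeries.coeff k S)))

/-- The system obtained after the first `k` changes of variables; its coefficients of
`ε^0, …, ε^{k-1}` no longer depend on `τ` and are unaffected by the later changes. -/
def kbSystem {n : ℕ} (m : ℕ) (A₀ : Matrix (Fin n) (Fin n) ℂ)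
    (B : ℤ → Matrix (Fin n) (Fin n) ℂ) : ℕ → PowerSeries (TrigPoly n)
  | 0 => initialSystem m A₀ B
  | k + 1 => kbStep k (kbSystem m A₀ B k)

/-- The coefficient `A_k` of the formal averaged system `dy/dt = (∑ ω⁻ᵏ A_k) y`. -/
def avgCoeff {n : ℕ} (m : ℕ) (A₀ : Matrix (Fin n) (Fin n) ℂ)
    (B : ℤ → Matrix (Fin n) (Fin n) ℂ) (k : ℕ) : Matrix (Fin n) (Fin n) ℂ :=
  meanValue (PowerSeries.coeff k (kbSystem m A₀ B (k + 1)))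

/-- The matrix `A_ω = A₀ + ω⁻¹ A₁ + ω⁻² A₂ + …` of the formal averaged system, as a matrix over the
ring of formal power series in `ω⁻¹`. -/
def avgMatrix {n : ℕ} (m : ℕ) (A₀ : Matrix (Fin n) (Fin n) ℂ)
    (B : ℤ → Matrix (Fin n) (Fin n) ℂ) : Matrix (Fin n) (Fin n) (PowerSeries ℂ) :=
  Matrix.of fun i j => PowerSeries.mk fun k => avgCoeff m A₀ B k i j

/-! ### Hurwitz determinants -/

/-- The coefficients `α_s` of `|λE - M| = λⁿ + α₁ λⁿ⁻¹ + … + α_n`, with `α₀ = 1` and `α_s = 0` for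
`s < 0` and for `s > n`. -/
def charCoeff {R : Type*} [CommRing R] {n : ℕ} (M : Matrix (Fin n) (Fin n) R) (s : ℤ) : R :=
  if 0 ≤ s ∧ s ≤ n then M.charpoly.coeff (n - s.toNat) else 0

/-- The Hurwitz matrix, with entry `α_{2i-j}` in row `i` and column `j` (counted from `1`). -/
def hurwitzMatrix {R : Type*} [CommRing R] {n : ℕ} (M : Matrix (Fin n) (Fin n) R) :
    Matrix (Fin n) (Fin n) R :=
  Matrix.of fun i j => charCoeff M (2 * ((i : ℤ) + 1) - ((j : ℤ) + 1))

/-- The Hurwitz determinants: `hurwitzDet M j` is the leading principal minor of size `j + 1` of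
the Hurwitz matrix, `j = 0, …, n - 1`. -/
def hurwitzDet {R : Type*} [CommRing R] {n : ℕ} (M : Matrix (Fin n) (Fin n) R) (j : Fin n) : R :=
  ((hurwitzMatrix M).submatrix (Fin.castLE j.isLt) (Fin.castLE j.isLt) :
    Matrix (Fin (j + 1)) (Fin (j + 1)) R).det

/-- The first nonzero coefficient of a (nonzero) formal power series. -/
def firstCoeff (f : PowerSeries ℂ) : ℂ := PowerSeries.coeff f.order.toNat f

end HighFreq

end

/-!
The stability of a periodic solution of a linear system is that of the homogeneous system, hence is
decided by the eigenvalues of the monodromy matrix `M(ω)` over the period `T = 2π/ω`. The proof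
writes `M = exp (T L)` with a real matrix `L(ω)` that has the same Hurwitz determinants as the formal
averaged matrix to any prescribed order in `ω⁻¹`, and then applies the Routh–Hurwitz criterion to
`L(ω)` itself, so that no perturbation theory of eigenvalues is needed.

* **Averaging.** The product `q` of the first `N` changes of variables is a polynomial in `ω⁻¹`. It
  intertwines the initial system and the truncated averaged one, with a remainder `O(ω⁻ᴺ)`
  (`exists_averaging_transform`). Functions paired with their formal expansions form a ring
  (`expansionSubring`), so this follows from the formal identities that define the procedure.
  Variation of constants over one period gives `U⁻¹ M U = exp (T A_N) + O(ω^{-N-1})`, with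
  `U = q(ω, 0)` and `A_N` the truncation of the formal averaged matrix (`exists_conj_monodromy`).
* **Logarithm.** The exponential is bi-Lipschitz near zero (`exists_log`), so that for large `ω` there
  is a small logarithm `T L` of `M`, and `L` is similar to `A_N + O(ω⁻ᴺ)`. Since `M` is real and small
  logarithms are unique, `L` is real (`exists_real_log`). Hurwitz determinants are polynomials in
  the entries and invariant under conjugation. Hence those of `L` are real with expansions
  `D_j + O(ω⁻ᴺ)`, and for large `ω` they have the signs of the leading coefficients
  (`HasScalarExpansion.hurwitzDet`).
* **Routh–Hurwitz.** One Routh step lowers the degree and removes the first factor of all Hurwitz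
  determinants (`hurwitzMinor_succ`). That it respects the location of the roots comes from an
  inequality of Julia type for finite Blaschke products (`julia_inequality`). This gives the
  sufficiency of positive determinants for stability (`re_neg_of_hurwitzMinor_pos`) and, when no
  determinant vanishes, the existence of a root in the open right half-plane as soon as one is
  negative (`hurwitzMinor_pos_of_re_nonpos`).
* **Floquet theory.** The eigenvalues of `M` are the exponentials of those of `T L`
  (`exists_eigenvalue_of_exp`). In the stable case the powers of `M` are bounded, in the unstable one
  `M` has an eigenvalue outside the unit disc. In both cases the last Hurwitz determinant is nonzero,
  so `1` is not a multiplier and the periodic solution exists and is unique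
  (`IsFundamental.existsUnique_periodic`).
-/

noncomputable section

namespace HighFreq

/-! ### The Routh–Hurwitz criterion -/

/-- The coefficients `a_s` of `p = a₀ xⁿ + a₁ xⁿ⁻¹ + … + a_n`, extended by zero to all integers. -/
def descCoeff {R : Type*} [Semiring R] (n : ℕ) (p : Polynomial R) (s : ℤ) : R :=
  if 0 ≤ s ∧ s ≤ n then p.coeff (n - s.toNat) else 0

/-- The leading principal minor of size `j` of the infinite Hurwitz matrix `a_{2i-k}`, with `i`
and `k` counted from `1`. -/
def hurwitzMinor {R : Type*} [CommRing R] (a : ℤ → R) (j : ℕ) : R :=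
  (Matrix.of fun i k : Fin j => a (2 * ((i : ℤ) + 1) - ((k : ℤ) + 1))).det

theorem hurwitzDet_eq_hurwitzMinor {R : Type*} [CommRing R] {n : ℕ}
    (M : Matrix (Fin n) (Fin n) R) (j : Fin n) :
    hurwitzDet M j = hurwitzMinor (descCoeff n M.charpoly) (j + 1) := rfl

/-- The effect of one Routh step on Hurwitz determinants: subtracting from each even column a
multiple of the column to its left clears the first row up to its first entry. -/
theorem hurwitzMinor_succ {R : Type*} [CommRing R] (a b : ℤ → R) (c : R)
    (ha : ∀ s < 0, a s = 0) (hc : c * a 1 = a 0)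
    (hodd : ∀ s, Odd s → b s = a (s + 1) - c * a (s + 2))
    (heven : ∀ s, Even s → b s = a (s + 1)) (j : ℕ) :
    hurwitzMinor a (j + 1) = a 1 * hurwitzMinor b j := by
  have h1 : hurwitzMinor a (j + 1)
      = (Matrix.of fun i k : Fin (j + 1) => b (2 * (i : ℤ) - (k : ℤ))).det := by
    symm
    apply Matrix.det_eq_of_forall_col_eq_smul_add_pred
      (fun k : Fin j => if Odd ((k : ℤ) + 1) then -c else 0)
    · intro i
      simp only [Matrix.of_apply, Fin.val_zero, Nat.cast_zero]
      rw [heven _ ⟨i, by ring⟩]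
      ring_nf
    · intro i k
      simp only [Matrix.of_apply, Fin.val_succ, Fin.val_castSucc, Nat.cast_add, Nat.cast_one]
      rcases Int.even_or_odd (k : ℤ) with hk | hk
      · have hk1 : Odd ((k : ℤ) + 1) := hk.add_one
        have e1 : Odd (2 * (i : ℤ) - ((k : ℤ) + 1)) := by
          obtain ⟨r, hr⟩ := hk; exact ⟨i - r - 1, by rw [hr]; ring⟩
        have e2 : Even (2 * (i : ℤ) - (k : ℤ)) := by
          obtain ⟨r, hr⟩ := hk; exact ⟨i - r, by rw [hr]; ring⟩
        rw [if_pos hk1, hodd _ e1, heven _ e2]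
        rw [show 2 * (i : ℤ) - ((k : ℤ) + 1) + 1 = 2 * ((i : ℤ) + 1) - ((k : ℤ) + 1 + 1) by ring,
          show 2 * (i : ℤ) - ((k : ℤ) + 1) + 2 = 2 * (i : ℤ) - (k : ℤ) + 1 by ring]
        ring
      · have hk1 : ¬ Odd ((k : ℤ) + 1) := by
          rw [Int.not_odd_iff_even]; exact hk.add_one
        have e1 : Even (2 * (i : ℤ) - ((k : ℤ) + 1)) := by
          obtain ⟨r, hr⟩ := hk; exact ⟨i - r - 1, by rw [hr]; ring⟩
        rw [if_neg hk1, heven _ e1, zero_mul, add_zero]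
        congr 1; ring
  rw [h1, Matrix.det_succ_row_zero, Fin.sum_univ_succ, Finset.sum_eq_zero]
  · have h0 : b 0 = a 1 := by rw [heven 0 (by simp)]; simp
    simp only [Fin.val_zero, pow_zero, one_mul, Matrix.of_apply, Nat.cast_zero, mul_zero, sub_zero,
      h0, add_zero, Fin.succAbove_zero, hurwitzMinor]
    congr 2
  · intro k _
    have : b (-((k : ℤ) + 1)) = 0 := by
      rcases Int.even_or_odd (-((k : ℤ) + 1)) with hk | hk
      · rw [heven _ hk]
        obtain ⟨r, hr⟩ := hk
        exact ha _ (by omega)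
      · rw [hodd _ hk]
        rcases Nat.eq_zero_or_pos (k : ℕ) with h0 | h0
        · simp [h0, hc]
        · rw [show a (-((k : ℤ) + 1) + 1) = 0 from ha _ (by omega)]
          obtain ⟨r, hr⟩ := hk
          rw [ha _ (by omega)]; simp
    have h2 : (Matrix.of fun i k : Fin (j + 1) => b (2 * (i : ℤ) - (k : ℤ))) 0 k.succ = 0 := by
      rw [← this]; simp
    rw [h2, mul_zero, zero_mul]

/-- If the constant term vanishes, the last Hurwitz determinant has a zero row. -/
theorem hurwitzMinor_eq_zero_of_coeff_zero {R : Type*} [CommRing R] {n : ℕ} (hn : 0 < n)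
    (p : Polynomial R) (hp : p.coeff 0 = 0) : hurwitzMinor (descCoeff n p) n = 0 := by
  apply Matrix.det_eq_zero_of_row_eq_zero ⟨n - 1, by omega⟩
  intro k
  simp only [Matrix.of_apply, descCoeff]
  split_ifs with h
  · obtain ⟨h1, h2⟩ := h
    have hk := k.isLt
    rw [← hp]; congr 1; omega
  · rfl

/-- The Cauchy–Schwarz step for products in `julia_inequality`. -/
theorem normSq_add_mul_le {u v : ℂ} {X σ ρ α β : ℝ} (hX : 0 ≤ X) (hσ : 0 ≤ σ) (hρ : 0 ≤ ρ)
    (hα : 0 ≤ α) (hβ : 0 ≤ β) (hu : ‖u‖ ^ 2 * X ≤ σ * α) (hv : ‖v‖ ^ 2 * X ≤ ρ * β) :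
    ‖u + v‖ ^ 2 * X ≤ (σ + ρ) * (α + β) := by
  have h1 : ‖u + v‖ ^ 2 ≤ (‖u‖ + ‖v‖) ^ 2 := by gcongr; exact norm_add_le u v
  have h2 : 2 * (‖u‖ * ‖v‖ * X) ≤ σ * β + ρ * α := by
    apply le_of_sq_le_sq _ (by positivity)
    have h3 : (‖u‖ ^ 2 * X) * (‖v‖ ^ 2 * X) ≤ (σ * α) * (ρ * β) := by gcongr
    nlinarith [sq_nonneg (σ * β - ρ * α)]
  nlinarith [mul_le_mul_of_nonneg_right h1 hX]

/-- A Julia type inequality for the finite Blaschke product `N / D` of the right half-plane with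
`D = ∏ (x - r)` and `N = ∏ (x + r̄)`. It is exact for one factor, and passes to products by the
Cauchy–Schwarz inequality. -/
theorem julia_inequality (s : Multiset ℂ) (hs : ∀ r ∈ s, r.re ≤ 0) (x : ℂ) (hx : 0 ≤ x.re) :
    let D := (s.map fun r => x - r).prod
    let N := (s.map fun r => x + (starRingEnd ℂ) r).prod
    ‖N‖ ^ 2 ≤ ‖D‖ ^ 2 ∧ (s.map Complex.re).sum ≤ 0 ∧
      ‖D - N‖ ^ 2 * x.re ≤ -(s.map Complex.re).sum * (‖D‖ ^ 2 - ‖N‖ ^ 2) := by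
  induction s using Multiset.induction with
  | empty => simp
  | cons r s ih =>
    obtain ⟨h1, h2, h3⟩ := ih fun r' hr' => hs r' (Multiset.mem_cons_of_mem hr')
    have hr : r.re ≤ 0 := hs r (Multiset.mem_cons_self r s)
    simp only [Multiset.map_cons, Multiset.prod_cons, Multiset.sum_cons]
    set D := (s.map fun r => x - r).prod
    set N := (s.map fun r => x + (starRingEnd ℂ) r).prod
    set τ := (s.map Complex.re).sum
    have key : ‖x - r‖ ^ 2 = ‖x + (starRingEnd ℂ) r‖ ^ 2 + 4 * x.re * (-r.re) := by
      rw [← Complex.normSq_eq_norm_sq, ← Complex.normSq_eq_norm_sq, Complex.normSq_apply,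
        Complex.normSq_apply]
      simp; ring
    have hβ : 0 ≤ 4 * x.re * (-r.re) * ‖N‖ ^ 2 := by
      have : 0 ≤ -r.re := by linarith
      positivity
    have hα : 0 ≤ ‖x - r‖ ^ 2 * (‖D‖ ^ 2 - ‖N‖ ^ 2) :=
      mul_nonneg (by positivity) (by linarith)
    have e : ‖(x - r) * D‖ ^ 2 - ‖(x + (starRingEnd ℂ) r) * N‖ ^ 2
        = ‖x - r‖ ^ 2 * (‖D‖ ^ 2 - ‖N‖ ^ 2) + 4 * x.re * (-r.re) * ‖N‖ ^ 2 := by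
      rw [norm_mul, norm_mul, mul_pow, mul_pow, key]; ring
    refine ⟨by linarith, by linarith, ?_⟩
    rw [e]
    have hu : ‖(x - r) * (D - N)‖ ^ 2 * x.re ≤ -τ * (‖x - r‖ ^ 2 * (‖D‖ ^ 2 - ‖N‖ ^ 2)) := by
      rw [norm_mul, mul_pow]
      nlinarith [mul_le_mul_of_nonneg_left h3 (sq_nonneg ‖x - r‖)]
    have hv : ‖(2 * (-r.re) : ℝ) * N‖ ^ 2 * x.re ≤ -r.re * (4 * x.re * (-r.re) * ‖N‖ ^ 2) := by
      rw [norm_mul, mul_pow, Complex.norm_real, Real.norm_eq_abs, sq_abs]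
      apply le_of_eq; ring
    have := normSq_add_mul_le hx (by linarith) (by linarith : 0 ≤ -r.re) hα hβ hu hv
    have e2 : (x - r) * D - (x + (starRingEnd ℂ) r) * N
        = (x - r) * (D - N) + (2 * (-r.re) : ℝ) * N := by
      have : (starRingEnd ℂ) r = 2 * (r.re : ℂ) - r := by
        apply Complex.ext <;> simp; ring
      rw [this]; push_cast; ring
    rw [e2]
    convert this using 1; ring

section RouthHurwitz

open Polynomial

/-- The half of `p` containing the monomials `x^k` with `n - k` odd, that is, the terms `a_s x^{n-s}`
with `s` odd. -/
def oddHalf (n : ℕ) (p : ℝ[X]) : ℝ[X] := C (1 / 2) * (p - C ((-1) ^ n) * p.comp (-X))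

theorem coeff_comp_neg_X {R : Type*} [CommRing R] (p : R[X]) (k : ℕ) :
    (p.comp (-X)).coeff k = (-1) ^ k * p.coeff k := by
  rw [show (-X : R[X]) = C (-1) * X by simp, comp_C_mul_X_coeff, mul_comm]

theorem coeff_oddHalf (n : ℕ) (p : ℝ[X]) (k : ℕ) :
    (oddHalf n p).coeff k = if Even (n + k) then 0 else p.coeff k := by
  rw [oddHalf, coeff_C_mul, coeff_sub, coeff_C_mul, coeff_comp_neg_X, ← mul_assoc, ← pow_add]
  split_ifs with hk
  · rw [hk.neg_one_pow]; ring
  · rw [(Nat.not_even_iff_odd.1 hk).neg_one_pow]; ring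

theorem aeval_oddHalf (n : ℕ) (p : ℝ[X]) (x : ℂ) :
    2 * aeval x (oddHalf n p) = aeval x p - (-1) ^ n * aeval (-x) p := by
  simp [oddHalf, aeval_comp]

/-- The Routh reduction of a polynomial of degree `n + 1`: with the ratio `c = a₀ / a₁` of the two
leading coefficients, subtract `c x` times the terms `a_s x^{n+1-s}`, `s` odd. -/
def routhStep (n : ℕ) (p : ℝ[X]) : ℝ[X] :=
  p - C (p.coeff (n + 1) / p.coeff n) * (X * oddHalf (n + 1) p)

/-- The Routh step lowers the degree by one and makes the second coefficient the leading one. -/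
theorem coeff_routhStep {n : ℕ} {p : ℝ[X]} (h1 : p.coeff n ≠ 0) (hp : p.natDegree ≤ n + 1) :
    (routhStep n p).natDegree ≤ n ∧ (routhStep n p).coeff n = p.coeff n := by
  have hd : (oddHalf (n + 1) p).natDegree ≤ n := by
    rw [natDegree_le_iff_coeff_eq_zero]
    intro N hN
    rw [coeff_oddHalf]
    split_ifs with h
    · rfl
    · rcases Nat.eq_or_lt_of_le (Nat.succ_le_of_lt hN) with h' | h'
      · exact absurd ⟨n + 1, by omega⟩ h
      · exact coeff_eq_zero_of_natDegree_lt (by omega)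
  constructor
  · rw [natDegree_le_iff_coeff_eq_zero]
    intro N hN
    obtain ⟨N, rfl⟩ : ∃ N', N = N' + 1 := ⟨N - 1, by omega⟩
    rw [routhStep, coeff_sub, coeff_C_mul, coeff_X_mul]
    rcases Nat.eq_or_lt_of_le (Nat.le_of_lt_succ hN) with h' | h'
    · subst h'
      rw [coeff_oddHalf, if_neg (by rw [Nat.not_even_iff_odd]; exact ⟨n, by ring⟩)]
      field_simp; ring
    · rw [coeff_eq_zero_of_natDegree_lt (by omega : p.natDegree < N + 1),
        coeff_eq_zero_of_natDegree_lt (by omega : (oddHalf (n + 1) p).natDegree < N)]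
      simp
  · rw [routhStep, coeff_sub, coeff_C_mul]
    cases n with
    | zero => simp
    | succ n =>
      rw [coeff_X_mul, coeff_oddHalf, if_pos ⟨n + 1, by ring⟩]; simp

theorem hurwitzMinor_routhStep {n : ℕ} {p : ℝ[X]} (h1 : p.coeff n ≠ 0)
    (j : ℕ) : hurwitzMinor (descCoeff (n + 1) p) (j + 1)
      = p.coeff n * hurwitzMinor (descCoeff n (routhStep n p)) j := by
  have ha1 : descCoeff (n + 1) p 1 = p.coeff n := by simp [descCoeff]
  have ha0 : descCoeff (n + 1) p 0 = p.coeff (n + 1) := by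
    simp only [descCoeff]; rw [if_pos (by omega)]; simp
  rw [← ha1]
  have hneg : ∀ s < 0, descCoeff (n + 1) p s = 0 := fun s hs => if_neg (by omega)
  -- both sequences agree with the formula of the Routh step, also at the ends of their ranges
  have hb : ∀ s : ℤ, -1 ≤ s → descCoeff n (routhStep n p) s = descCoeff (n + 1) p (s + 1)
      - (if Odd s then p.coeff (n + 1) / p.coeff n * descCoeff (n + 1) p (s + 2) else 0) := by
    intro s hs
    rcases eq_or_lt_of_le hs with rfl | hs
    · rw [if_pos (by decide)]
      norm_num
      rw [ha0, ha1]
      simp only [descCoeff]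
      rw [if_neg (by omega)]
      field_simp; ring
    · obtain ⟨s, rfl⟩ := Int.eq_ofNat_of_zero_le (by omega : 0 ≤ s)
      by_cases hsn : s ≤ n
      · obtain ⟨k, rfl⟩ := Nat.exists_eq_add_of_le hsn
        simp only [descCoeff]
        rw [if_pos (by push_cast; omega), if_pos (by push_cast; omega), routhStep, coeff_sub,
          coeff_C_mul]
        rw [show s + k - (s : ℤ).toNat = k by omega,
          show s + k + 1 - ((s : ℤ) + 1).toNat = k by omega]
        congr 1
        cases k with
        | zero =>
          rw [if_neg (by push_cast; omega : ¬ (0 ≤ (s : ℤ) + 2 ∧ (s : ℤ) + 2 ≤ ↑(s + 0 + 1)))]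
          simp
        | succ k =>
          rw [coeff_X_mul, coeff_oddHalf,
            if_pos (by push_cast; omega : 0 ≤ (s : ℤ) + 2 ∧ (s : ℤ) + 2 ≤ ↑(s + (k + 1) + 1)),
            show s + (k + 1) + 1 - ((s : ℤ) + 2).toNat = k by omega]
          have : Even (s + (k + 1) + 1 + k) ↔ ¬ Odd (s : ℤ) := by
            rw [Int.not_odd_iff_even]
            norm_cast
            rw [show s + (k + 1) + 1 + k = s + 2 * (k + 1) by ring, Nat.even_add]
            simp
          simp only [this]
          by_cases ho : Odd (s : ℤ) <;> simp [ho]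
      · simp only [descCoeff]
        rw [if_neg (by omega : ¬ (0 ≤ (s : ℤ) ∧ (s : ℤ) ≤ n)),
          if_neg (by omega : ¬ (0 ≤ (s : ℤ) + 1 ∧ (s : ℤ) + 1 ≤ ↑(n + 1))),
          if_neg (by omega : ¬ (0 ≤ (s : ℤ) + 2 ∧ (s : ℤ) + 2 ≤ ↑(n + 1)))]
        simp
  refine hurwitzMinor_succ _ _ (p.coeff (n + 1) / p.coeff n) hneg ?_ ?_ ?_ j
  · rw [ha1, ha0]; field_simp
  · intro s hs
    rcases lt_or_ge s (-1) with h | h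
    · rw [hneg _ (by omega), hneg _ (by obtain ⟨r, hr⟩ := hs; omega)]
      simp only [descCoeff]
      rw [if_neg (by omega)]; simp
    · rw [hb s h, if_pos hs]
  · intro s hs
    rcases lt_or_ge s (-1) with h | h
    · rw [hneg _ (by omega)]
      exact if_neg (by omega)
    · rw [hb s h, if_neg (by rwa [Int.not_odd_iff_even])]; simp

/-- For a real polynomial, `p(x)` and `(-1)ⁿ p(-x)` are the two products in `julia_inequality`, up
to the common factor given by the leading coefficient. -/
theorem exists_roots {n : ℕ} {p : ℝ[X]} (hp : p.natDegree = n) (hp0 : p.coeff n ≠ 0) :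
    ∃ s : Multiset ℂ, (∀ r ∈ s, aeval r p = 0) ∧
      (∀ x : ℂ, aeval x p = p.coeff n * (s.map fun r => x - r).prod) ∧
      (∀ x : ℂ, (-1) ^ n * aeval (-x) p
        = p.coeff n * (s.map fun r => x + (starRingEnd ℂ) r).prod) ∧
      (n ≠ 0 → p.coeff (n - 1) = p.coeff n * (-(s.map Complex.re).sum)) := by
  set P : ℂ[X] := p.map (algebraMap ℝ ℂ) with hP
  have hspl : P.Splits := IsAlgClosed.splits P
  have hdeg : P.natDegree = n := by rw [hP, natDegree_map, hp]
  have hlead : P.leadingCoeff = p.coeff n := by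
    rw [leadingCoeff, hdeg, hP, coeff_map]; rfl
  have hP0 : P ≠ 0 := by
    intro h; rw [h] at hlead; simp at hlead; exact hp0 (by exact_mod_cast hlead.symm)
  have hev : ∀ x : ℂ, aeval x p = P.eval x := fun x => by
    rw [hP, eval_map_algebraMap]
  have hprod : ∀ x : ℂ, aeval x p = p.coeff n * (P.roots.map fun r => x - r).prod := by
    intro x
    rw [hev, ← hlead]
    exact hspl.eval_eq_prod_roots x
  refine ⟨P.roots, fun r hr => ?_, hprod, fun x => ?_, fun hn => ?_⟩
  · rw [hev]; exact (mem_roots hP0).1 hr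
  · have h1 : aeval (-x) p = (starRingEnd ℂ) (aeval (-(starRingEnd ℂ) x) p) := by
      have : -x = (starRingEnd ℂ) (-(starRingEnd ℂ) x) := by simp
      conv_lhs => rw [this]
      exact aeval_conj _ _
    have hcard : n = P.roots.card := by rw [← hdeg]; exact hspl.natDegree_eq_card_roots
    rw [h1, hprod, map_mul, Complex.conj_ofReal, map_multiset_prod, Multiset.map_map]
    rw [mul_left_comm]
    congr 1
    rw [hcard, ← Multiset.card_map ((starRingEnd ℂ) ∘ fun r => -(starRingEnd ℂ) x - r),
      ← Multiset.prod_map_neg, Multiset.map_map]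
    congr 1
    apply Multiset.map_congr rfl
    intro r _
    simp; ring
  · have h := hspl.nextCoeff_eq_neg_sum_roots_mul_leadingCoeff
    rw [hlead, nextCoeff_of_natDegree_pos (by omega), hdeg, hP, coeff_map] at h
    have h2 := congrArg Complex.re h
    have h3 : (P.roots.map Complex.re).sum = P.roots.sum.re := by
      have := map_multiset_sum Complex.reAddGroupHom P.roots
      simpa using this.symm
    rw [h3]
    simp at h2
    rw [h2]; ring

/-- Sufficiency in the Routh–Hurwitz criterion. -/
theorem re_neg_of_hurwitzMinor_pos (n : ℕ) : ∀ (p : ℝ[X]), p.natDegree = n → 0 < p.coeff n →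
    (∀ j < n, 0 < hurwitzMinor (descCoeff n p) (j + 1)) →
    ∀ x : ℂ, aeval x p = 0 → x.re < 0 := by
  induction n with
  | zero =>
    intro p hp h0 _ x hx
    rw [eq_C_of_natDegree_eq_zero hp] at hx
    simp at hx; exact absurd hx h0.ne'
  | succ n ih =>
    intro p hp h0 hD x hx
    have h1 : 0 < p.coeff n := by
      have := hD 0 (by omega)
      simpa [hurwitzMinor, descCoeff] using this
    obtain ⟨hqd, hqc⟩ := coeff_routhStep h1.ne' hp.le
    set q := routhStep n p with hq
    have hqd' : q.natDegree = n :=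
      le_antisymm hqd (le_natDegree_of_ne_zero (by rw [hqc]; exact h1.ne'))
    have hq_roots := ih q hqd' (by rw [hqc]; exact h1) (fun j hj => by
      have := hD (j + 1) (by omega)
      rw [hurwitzMinor_routhStep h1.ne'] at this
      exact pos_of_mul_pos_right this h1.le)
    by_contra! hxre
    obtain ⟨s, hs1, hs2, hs3, -⟩ := exists_roots hqd' (by rw [hqc]; exact h1.ne')
    obtain ⟨hN, -, -⟩ := julia_inequality s (fun r hr => (hq_roots r (hs1 r hr)).le) x hxre
    have hqx : aeval x q ≠ 0 := fun h => absurd (hq_roots x h) (by linarith)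
    set c := p.coeff (n + 1) / p.coeff n with hc
    have hcpos : 0 < c := by positivity
    -- the odd halves of `p` and `q` coincide
    have ho : oddHalf (n + 1) p = C (1 / 2) * (q + C ((-1) ^ n) * q.comp (-X)) := by
      ext k
      rw [coeff_oddHalf, coeff_C_mul, coeff_add, coeff_C_mul, coeff_comp_neg_X]
      have hqk : q.coeff k = p.coeff k - c * (X * oddHalf (n + 1) p).coeff k := by
        rw [hq, routhStep, coeff_sub, coeff_C_mul]
      rw [hqk]
      split_ifs with hk
      · have : (-1 : ℝ) ^ n * (-1) ^ k = -1 := by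
          rw [← pow_add]; apply Odd.neg_one_pow
          rw [← Nat.not_even_iff_odd]; intro h
          rw [show n + 1 + k = n + k + 1 by ring, Nat.even_add_one] at hk; exact hk h
        linear_combination (-1 / 2) *
          (p.coeff k - c * (X * oddHalf (n + 1) p).coeff k) * this
      · have hk' : Even (n + k) := by
          rw [show n + 1 + k = n + k + 1 by ring, Nat.even_add_one, not_not] at hk; exact hk
        have : (-1 : ℝ) ^ n * (-1) ^ k = 1 := by
          rw [← pow_add]; exact hk'.neg_one_pow
        have h0 : (X * oddHalf (n + 1) p).coeff k = 0 := by
          cases k with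
          | zero => simp
          | succ k =>
            rw [coeff_X_mul, coeff_oddHalf, if_pos]
            rw [show n + 1 + k = n + (k + 1) by ring]; exact hk'
        rw [h0]
        linear_combination (-1 / 2) * p.coeff k * this
    set D := (s.map fun r => x - r).prod
    set N := (s.map fun r => x + (starRingEnd ℂ) r).prod
    have hox : 2 * aeval x (oddHalf (n + 1) p) = p.coeff n * (D + N) := by
      rw [ho]
      simp only [map_mul, map_add, aeval_C, aeval_comp, map_neg, aeval_X]
      have e3 := hs3 x
      rw [hs2, ← hqc]
      simp only [map_pow, map_neg, map_one, map_div₀, Complex.coe_algebraMap] at *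
      rw [e3]
      push_cast
      ring
    have hpx : aeval x p = aeval x q + c * (x * aeval x (oddHalf (n + 1) p)) := by
      rw [hq, routhStep]; simp [hc]
    have hD0 : D ≠ 0 := by
      intro h; apply hqx; rw [hs2]; simp [D] at h ⊢; right; exact h
    have hlin : 2 * D + c * x * (D + N) = 0 := by
      have h1' : (p.coeff n : ℂ) ≠ 0 := by exact_mod_cast h1.ne'
      apply mul_left_cancel₀ h1'
      rw [hs2 x, hqc] at hpx
      linear_combination (-2 : ℂ) * hpx + 2 * hx - (c * x) * hox
    -- hence `D + N ≠ 0` and `D / (D + N)`, whose real part is at least `1/2`, equals `-c x / 2`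
    have hDN : D + N ≠ 0 := by
      intro h; rw [h] at hlin; simp at hlin; exact hD0 hlin
    have hD' : D = -(c * x / 2) * (D + N) := by linear_combination (1 / 2 : ℂ) * hlin
    have hN' : N = (1 + c * x / 2) * (D + N) := by linear_combination -(1 / 2 : ℂ) * hlin
    have hle : ‖1 + c * x / 2‖ ^ 2 ≤ ‖-(c * x / 2)‖ ^ 2 := by
      have hpos : 0 < ‖D + N‖ ^ 2 := by have := norm_pos_iff.2 hDN; positivity
      apply le_of_mul_le_mul_right _ hpos
      rw [← mul_pow, ← mul_pow, ← norm_mul, ← norm_mul, ← hD', ← hN']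
      exact hN
    rw [← Complex.normSq_eq_norm_sq, ← Complex.normSq_eq_norm_sq, Complex.normSq_apply,
      Complex.normSq_apply] at hle
    have e : (c * x / 2 : ℂ) = ((c / 2 : ℝ) : ℂ) * x := by push_cast; ring
    rw [e] at hle
    simp at hle
    nlinarith [mul_nonneg hcpos.le hxre]

/-- Necessity in the Routh–Hurwitz criterion, in the closed form suited to instability: if no root
lies in the open right half-plane and the Hurwitz determinants do not vanish, they are positive. -/
theorem hurwitzMinor_pos_of_re_nonpos (n : ℕ) : ∀ (p : ℝ[X]), p.natDegree = n → 0 < p.coeff n →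
    (∀ j < n, hurwitzMinor (descCoeff n p) (j + 1) ≠ 0) →
    (∀ x : ℂ, aeval x p = 0 → x.re ≤ 0) →
    ∀ j < n, 0 < hurwitzMinor (descCoeff n p) (j + 1) := by
  induction n with
  | zero => intro p _ _ _ _ j hj; omega
  | succ n ih =>
    intro p hp h0 hD hroots
    obtain ⟨s, hs1, hs2, hs3, hs4⟩ := exists_roots hp h0.ne'
    have hsre : ∀ r ∈ s, r.re ≤ 0 := fun r hr => hroots r (hs1 r hr)
    have hne : p.coeff n ≠ 0 := by
      have := hD 0 (by omega)
      simpa [hurwitzMinor, descCoeff] using this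
    have hσ := hs4 (by omega)
    simp only [Nat.add_sub_cancel] at hσ
    have h1 : 0 < p.coeff n := by
      obtain ⟨-, h, -⟩ := julia_inequality s hsre 0 (by simp)
      refine lt_of_le_of_ne ?_ hne.symm
      rw [hσ]; exact mul_nonneg h0.le (by linarith)
    set σ := -(s.map Complex.re).sum with hσdef
    have hσpos : 0 < σ := by rw [hσ] at h1; exact pos_of_mul_pos_right h1 h0.le
    obtain ⟨hqd, hqc⟩ := coeff_routhStep h1.ne' hp.le
    have hqd' : (routhStep n p).natDegree = n :=
      le_antisymm hqd (le_natDegree_of_ne_zero (by rw [hqc]; exact h1.ne'))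
    have hpos : ∀ j < n, 0 < hurwitzMinor (descCoeff n (routhStep n p)) (j + 1) := by
      apply ih _ hqd' (by rw [hqc]; exact h1)
      · intro j hj h
        apply hD (j + 1) (by omega)
        rw [hurwitzMinor_routhStep hne, h, mul_zero]
      · intro x hx
        by_contra! hxre
        obtain ⟨hN, -, hJ⟩ := julia_inequality s hsre x hxre.le
        rw [← hσdef] at hJ
        set D := (s.map fun r => x - r).prod
        set N := (s.map fun r => x + (starRingEnd ℂ) r).prod
        have hx0 : x ≠ 0 := by rintro rfl; simp at hxre
        have hpx : aeval x p ≠ 0 := fun h => absurd (hroots x h) (by linarith)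
        have hD0 : D ≠ 0 := by
          intro h; apply hpx; rw [hs2]; simp [D] at h ⊢; right; exact h
        have hox := aeval_oddHalf (n + 1) p x
        rw [hs3, hs2] at hox
        have hqx : aeval x p - (p.coeff (n + 1) / p.coeff n : ℝ)
            * (x * aeval x (oddHalf (n + 1) p)) = 0 := by
          rw [← hx, routhStep]; simp
        have ha0 : (p.coeff (n + 1) : ℂ) ≠ 0 := by exact_mod_cast h0.ne'
        have hc : p.coeff (n + 1) / p.coeff n = σ⁻¹ := by
          rw [hσ]; field_simp
        have hσ0 : (σ : ℂ) ≠ 0 := by exact_mod_cast hσpos.ne'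
        have hlin : x * (D - N) = 2 * σ * D := by
          rw [hc, hs2] at hqx
          push_cast at hqx
          field_simp at hqx
          apply mul_left_cancel₀ ha0
          linear_combination (-2 : ℂ) * hqx - x * hox
        -- `D - N = (2σ/x) D` contradicts the Julia inequality
        have e1 : ‖x‖ ^ 2 * ‖D - N‖ ^ 2 = 4 * σ ^ 2 * ‖D‖ ^ 2 := by
          rw [← mul_pow, ← norm_mul, hlin, norm_mul, norm_mul, Complex.norm_real,
            Real.norm_of_nonneg hσpos.le]
          norm_num; ring
        have e2 : ‖x‖ ^ 2 * ‖N‖ ^ 2 = ‖x - 2 * σ‖ ^ 2 * ‖D‖ ^ 2 := by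
          rw [← mul_pow, ← mul_pow, ← norm_mul, ← norm_mul]
          congr 2; linear_combination (-1 : ℂ) * hlin
        have e3 : ‖x - 2 * σ‖ ^ 2 = ‖x‖ ^ 2 - 4 * σ * x.re + 4 * σ ^ 2 := by
          rw [← Complex.normSq_eq_norm_sq, ← Complex.normSq_eq_norm_sq, Complex.normSq_apply,
            Complex.normSq_apply]
          simp; ring
        have hDpos : 0 < ‖D‖ ^ 2 := by have := norm_pos_iff.2 hD0; positivity
        have := mul_le_mul_of_nonneg_left hJ (sq_nonneg ‖x‖)
        have e4 : ‖x‖ ^ 2 * (‖D - N‖ ^ 2 * x.re) = 4 * σ ^ 2 * ‖D‖ ^ 2 * x.re := by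
          rw [← e1]; ring
        have e5 : ‖x‖ ^ 2 * (σ * (‖D‖ ^ 2 - ‖N‖ ^ 2))
            = σ * ‖D‖ ^ 2 * (4 * σ * x.re - 4 * σ ^ 2) := by
          have : ‖x‖ ^ 2 * (σ * (‖D‖ ^ 2 - ‖N‖ ^ 2))
            = σ * (‖x‖ ^ 2 * ‖D‖ ^ 2 - ‖x‖ ^ 2 * ‖N‖ ^ 2) := by ring
          rw [this, e2, e3]; ring
        rw [e4, e5] at this
        have h6 : 0 < σ ^ 3 * ‖D‖ ^ 2 := by positivity
        nlinarith
    intro j hj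
    rw [hurwitzMinor_routhStep hne]
    cases j with
    | zero => simpa [hurwitzMinor] using h1
    | succ j => exact mul_pos h1 (hpos j (by omega))

end RouthHurwitz

/-! ### Asymptotic expansions along a filter -/

section Expansion

open Asymptotics PowerSeries

variable {ι R 𝔸 : Type*} [Ring R] [NormedRing 𝔸] [NormedAlgebra ℝ 𝔸]

/-- `f` is represented up to `O(ε^N)` by the formal power series `F` in `ε`. The coefficients of `F`
lie in a ring `R` of symbols, which are evaluated at the parameter `i` by the ring homomorphism
`e i`. -/
def HasExpansion (l : Filter ι) (ε : ι → ℝ) (e : ι → R →+* 𝔸) (N : ℕ) (f : ι → 𝔸)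
    (F : R⟦X⟧) : Prop :=
  (fun i => f i - ∑ k ∈ Finset.range N, ε i ^ k • e i (coeff k F)) =O[l] fun i => ε i ^ N

variable {l : Filter ι} {ε : ι → ℝ} {e : ι → R →+* 𝔸} {N : ℕ} {f g : ι → 𝔸} {F G : R⟦X⟧}

theorem isBigO_pow_of_le (hε : ε =O[l] fun _ => (1 : ℝ)) {N k : ℕ} (h : N ≤ k) :
    (fun i => ε i ^ k) =O[l] fun i => ε i ^ N := by
  obtain ⟨j, rfl⟩ := Nat.exists_eq_add_of_le h
  have := (isBigO_refl (fun i => ε i ^ N) l).mul (hε.pow j)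
  simpa [pow_add] using this

theorem isBigO_pow_smul (he : ∀ r, (fun i => e i r) =O[l] fun _ => (1 : ℝ)) (k : ℕ) (r : R) :
    (fun i => ε i ^ k • e i r) =O[l] fun i => ε i ^ k := by
  simpa using (isBigO_refl (fun i => ε i ^ k) l).smul (he r)

theorem HasExpansion.mono (hε : ε =O[l] fun _ => (1 : ℝ))
    (he : ∀ r, (fun i => e i r) =O[l] fun _ => (1 : ℝ)) {K : ℕ} (hK : K ≤ N)
    (h : HasExpansion l ε e N f F) : HasExpansion l ε e K f F := by
  have h1 : (fun i => ∑ k ∈ Finset.Ico K N, ε i ^ k • e i (coeff k F)) =O[l]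
      fun i => ε i ^ K := by
    apply IsBigO.fun_sum
    intro k hk
    exact (isBigO_pow_smul he k _).trans (isBigO_pow_of_le hε (Finset.mem_Ico.1 hk).1)
  have h2 := (h.trans (isBigO_pow_of_le hε hK)).add h1
  refine h2.congr_left fun i => ?_
  rw [← Finset.sum_range_add_sum_Ico _ hK]
  abel

theorem HasExpansion.isBigO_one (hε : ε =O[l] fun _ => (1 : ℝ))
    (he : ∀ r, (fun i => e i r) =O[l] fun _ => (1 : ℝ))
    (h : HasExpansion l ε e N f F) : f =O[l] fun _ => (1 : ℝ) := by
  simpa [HasExpansion] using h.mono hε he (Nat.zero_le N)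

theorem HasExpansion.add (hf : HasExpansion l ε e N f F) (hg : HasExpansion l ε e N g G) :
    HasExpansion l ε e N (f + g) (F + G) := by
  refine (IsBigO.add hf hg).congr_left fun i => ?_
  simp only [map_add, smul_add, Finset.sum_add_distrib, Pi.add_apply]
  abel

theorem HasExpansion.neg (hf : HasExpansion l ε e N f F) :
    HasExpansion l ε e N (-f) (-F) := by
  refine (IsBigO.neg_left hf).congr_left fun i => ?_
  simp only [map_neg, smul_neg, Finset.sum_neg_distrib, Pi.neg_apply]
  abel

theorem HasExpansion.sub (hf : HasExpansion l ε e N f F) (hg : HasExpansion l ε e N g G) :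
    HasExpansion l ε e N (f - g) (F - G) := by
  rw [sub_eq_add_neg, sub_eq_add_neg]; exact hf.add hg.neg

theorem HasExpansion.mul (hε : ε =O[l] fun _ => (1 : ℝ))
    (he : ∀ r, (fun i => e i r) =O[l] fun _ => (1 : ℝ))
    (hf : HasExpansion l ε e N f F) (hg : HasExpansion l ε e N g G) :
    HasExpansion l ε e N (f * g) (F * G) := by
  set p : ι → 𝔸 := fun i => ∑ k ∈ Finset.range N, ε i ^ k • e i (coeff k F) with hp
  set q : ι → 𝔸 := fun i => ∑ k ∈ Finset.range N, ε i ^ k • e i (coeff k G) with hq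
  have hp1 : p =O[l] fun _ => (1 : ℝ) := by
    apply IsBigO.fun_sum
    intro k _
    simpa using (isBigO_pow_smul he k _).trans (isBigO_pow_of_le hε (Nat.zero_le k))
  have h1 : (fun i => (f i - p i) * g i) =O[l] fun i => ε i ^ N := by
    simpa using IsBigO.mul hf (hg.isBigO_one hε he)
  have h2 : (fun i => p i * (g i - q i)) =O[l] fun i => ε i ^ N := by
    simpa using IsBigO.mul hp1 hg
  -- the products of total degree at least `N`
  have h3 : (fun i => ∑ a ∈ Finset.range N, ∑ b ∈ Finset.Ico (N - a) N,
      ε i ^ (a + b) • e i (coeff a F * coeff b G)) =O[l] fun i => ε i ^ N := by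
    apply IsBigO.fun_sum
    intro a _
    apply IsBigO.fun_sum
    intro b hb
    have := (Finset.mem_Ico.1 hb).1
    exact (isBigO_pow_smul he _ _).trans (isBigO_pow_of_le hε (by omega))
  refine ((h1.add h2).add h3).congr_left fun i => ?_
  have e1 : p i * q i = ∑ a ∈ Finset.range N, ∑ b ∈ Finset.range N,
      ε i ^ (a + b) • e i (coeff a F * coeff b G) := by
    simp only [hp, hq]
    rw [Finset.sum_mul_sum]
    refine Finset.sum_congr rfl fun a _ => Finset.sum_congr rfl fun b _ => ?_
    rw [map_mul, smul_mul_smul_comm, pow_add]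
  have e2 : ∑ k ∈ Finset.range N, ε i ^ k • e i (coeff k (F * G))
      = ∑ a ∈ Finset.range N, ∑ b ∈ Finset.range (N - a),
      ε i ^ (a + b) • e i (coeff a F * coeff b G) := by
    rw [← Finset.sum_range_diag_flip N
      fun a b => ε i ^ (a + b) • e i (coeff a F * coeff b G)]
    refine Finset.sum_congr rfl fun k _ => ?_
    rw [coeff_mul, Finset.Nat.sum_antidiagonal_eq_sum_range_succ
      (fun a b => coeff a F * coeff b G), map_sum, Finset.smul_sum]
    refine Finset.sum_congr rfl fun a ha => ?_
    rw [Nat.add_sub_cancel' (Nat.lt_succ_iff.1 (Finset.mem_range.1 ha))]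
  have e3 : p i * q i = (∑ k ∈ Finset.range N, ε i ^ k • e i (coeff k (F * G)))
      + ∑ a ∈ Finset.range N, ∑ b ∈ Finset.Ico (N - a) N,
      ε i ^ (a + b) • e i (coeff a F * coeff b G) := by
    rw [e1, e2, ← Finset.sum_add_distrib]
    refine Finset.sum_congr rfl fun a _ => ?_
    rw [Finset.sum_range_add_sum_Ico _ (Nat.sub_le N a)]
  have e4 : (f i - p i) * g i + p i * (g i - q i) = f i * g i - p i * q i := by noncomm_ring
  rw [e4, e3, Pi.mul_apply]
  abel

theorem hasExpansion_monomial (hε : ε =O[l] fun _ => (1 : ℝ))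
    (he : ∀ r, (fun i => e i r) =O[l] fun _ => (1 : ℝ)) (k : ℕ) (r : R) :
    HasExpansion l ε e N (fun i => ε i ^ k • e i r) (monomial k r) := by
  unfold HasExpansion
  have h : ∀ i, ∑ j ∈ Finset.range N, ε i ^ j • e i (coeff j (monomial k r))
      = if k < N then ε i ^ k • e i r else 0 := by
    intro i
    simp only [coeff_monomial, apply_ite (e i), map_zero, smul_ite, smul_zero]
    simp
  simp only [h]
  split_ifs with hk
  · simpa using isBigO_zero _ _
  · simpa using (isBigO_pow_smul he k r).trans (isBigO_pow_of_le hε (by omega))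

theorem hasExpansion_one (hε : ε =O[l] fun _ => (1 : ℝ))
    (he : ∀ r, (fun i => e i r) =O[l] fun _ => (1 : ℝ)) :
    HasExpansion l ε e N 1 1 := by
  have := hasExpansion_monomial (N := N) hε he 0 1
  rw [monomial_zero_eq_C_apply, map_one] at this
  convert this using 1
  funext i; simp

/-- The pairs of a function and a power series representing it form a ring. -/
def expansionSubring (hε : ε =O[l] fun _ => (1 : ℝ))
    (he : ∀ r, (fun i => e i r) =O[l] fun _ => (1 : ℝ)) (N : ℕ) : Subring ((ι → 𝔸) × R⟦X⟧) where
  carrier := {x | HasExpansion l ε e N x.1 x.2}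
  mul_mem' := HasExpansion.mul hε he
  one_mem' := hasExpansion_one hε he
  add_mem' := HasExpansion.add
  zero_mem' := by
    simpa [HasExpansion] using isBigO_zero _ _
  neg_mem' := HasExpansion.neg

end Expansion

/-! ### Evaluation of matrix trigonometric polynomials -/

variable {n : ℕ}

/-- The character `l ↦ e^{i l τ}` with values in the scalar matrices. -/
def trigChar (n : ℕ) (τ : ℝ) : Multiplicative ℤ →* Matrix (Fin n) (Fin n) ℂ where
  toFun l := Complex.exp (Complex.I * (Multiplicative.toAdd l : ℤ) * τ) • 1
  map_one' := by simp
  map_mul' a b := by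
    rw [smul_mul_smul_comm, mul_one, ← Complex.exp_add, toAdd_mul]
    congr 2; push_cast; ring

theorem commute_trigChar (τ : ℝ) (a : Matrix (Fin n) (Fin n) ℂ) (l : Multiplicative ℤ) :
    Commute (RingHom.id _ a) (trigChar n τ l) :=
  (Commute.one_right a).smul_right _

/-- The value at `τ` of a matrix-valued trigonometric polynomial. -/
def trigEval (τ : ℝ) : TrigPoly n →+* Matrix (Fin n) (Fin n) ℂ :=
  AddMonoidAlgebra.liftNCRingHom (RingHom.id _) (trigChar n τ) (commute_trigChar τ)

theorem trigEval_C_mul_T (τ : ℝ) (a : Matrix (Fin n) (Fin n) ℂ) (l : ℤ) :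
    trigEval τ (LaurentPolynomial.C a * LaurentPolynomial.T l)
      = Complex.exp (Complex.I * l * τ) • a := by
  rw [← LaurentPolynomial.single_eq_C_mul_T, trigEval, AddMonoidAlgebra.liftNCRingHom_single]
  simp [trigChar]

theorem trigEval_C (τ : ℝ) (a : Matrix (Fin n) (Fin n) ℂ) :
    trigEval τ (LaurentPolynomial.C a) = a := by
  simpa using trigEval_C_mul_T τ a 0

theorem trigEval_eq_sum (τ : ℝ) (V : TrigPoly n) :
    trigEval τ V = ∑ l ∈ V.coeff.support, Complex.exp (Complex.I * l * τ) • V.coeff l := by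
  conv_lhs => rw [← AddMonoidAlgebra.sum_coeff_single V]
  rw [Finsupp.sum, map_sum]
  refine Finset.sum_congr rfl fun l _ => ?_
  rw [LaurentPolynomial.single_eq_C_mul_T, trigEval_C_mul_T]

theorem trigEval_add_two_pi (τ : ℝ) (V : TrigPoly n) :
    trigEval (τ + 2 * Real.pi) V = trigEval τ V := by
  rw [trigEval_eq_sum, trigEval_eq_sum]
  refine Finset.sum_congr rfl fun l _ => ?_
  congr 1
  rw [Complex.exp_eq_exp_iff_exists_int]
  exact ⟨l, by push_cast; ring⟩

theorem trigEval_oscPart (τ : ℝ) (V : TrigPoly n) :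
    trigEval τ (oscPart V)
      = ∑ l ∈ V.coeff.support.erase 0, Complex.exp (Complex.I * l * τ) • V.coeff l := by
  rw [oscPart, map_sub, trigEval_C, trigEval_eq_sum, meanValue]
  by_cases h : (0 : ℤ) ∈ V.coeff.support
  · rw [← Finset.add_sum_erase _ _ h]; simp
  · rw [Finset.erase_eq_of_notMem h, Finsupp.notMem_support_iff.1 h, sub_zero]

/-! ### The averaging changes of variables -/

/-- The change of variables made in `kbStep k S`. -/
def kbChange (k : ℕ) (S : PowerSeries (TrigPoly n)) : PowerSeries (TrigPoly n) :=
  1 + PowerSeries.monomial (k + 1) (zeroMeanPrimitive (PowerSeries.coeff k S))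

theorem kbChange_mul_kbStep (k : ℕ) (S : PowerSeries (TrigPoly n)) :
    kbChange k S * kbStep k S
      = S * kbChange k S - PowerSeries.monomial k (oscPart (PowerSeries.coeff k S)) := by
  rw [kbStep, ← mul_assoc]
  change (kbChange k S * PowerSeries.invOfUnit (kbChange k S) 1) * _ = _
  rw [PowerSeries.mul_invOfUnit, one_mul]
  · rfl
  · rw [kbChange, ← PowerSeries.coeff_zero_eq_constantCoeff_apply, map_add,
      PowerSeries.coeff_monomial]
    simp

/-- If `Q` intertwines `S₀` and `S`, the product `Q P` intertwines `S₀` and the system `S'` obtained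
from `S` by the change of variables `P`; here `V` is the derivative of `P`. -/
theorem intertwine_comp {R : Type*} [Ring R] {S₀ S S' Q P V : R} (h : P * S' = S * P - V) :
    S₀ * (Q * P) - Q * P * S' = (S₀ * Q - Q * S) * P + Q * V := by
  rw [mul_assoc Q P S', h, sub_mul, mul_sub, mul_assoc, mul_assoc]
  abel

/-- The `k`-th step replaces the coefficient of `ε^k` by its mean value and leaves the lower ones
unchanged. -/
theorem coeff_kbStep {k i : ℕ} (hi : i ≤ k) (S : PowerSeries (TrigPoly n)) :
    PowerSeries.coeff i (kbStep k S) = if i = k then LaurentPolynomial.C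
      (meanValue (PowerSeries.coeff k S)) else PowerSeries.coeff i S := by
  have h := congrArg (PowerSeries.coeff i) (kbChange_mul_kbStep k S)
  have e1 : ∀ (U : TrigPoly n) (G : PowerSeries (TrigPoly n)),
      PowerSeries.coeff i (PowerSeries.monomial (k + 1) U * G) = 0 := by
    intro U G
    rw [PowerSeries.coeff_mul]
    refine Finset.sum_eq_zero fun x hx => ?_
    rw [PowerSeries.coeff_monomial, if_neg, zero_mul]
    have := Finset.HasAntidiagonal.mem_antidiagonal.1 hx
    omega
  have e2 : ∀ (U : TrigPoly n) (G : PowerSeries (TrigPoly n)),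
      PowerSeries.coeff i (G * PowerSeries.monomial (k + 1) U) = 0 := by
    intro U G
    rw [PowerSeries.coeff_mul]
    refine Finset.sum_eq_zero fun x hx => ?_
    rw [PowerSeries.coeff_monomial, if_neg, mul_zero]
    have := Finset.HasAntidiagonal.mem_antidiagonal.1 hx
    omega
  rw [kbChange, add_mul, mul_add, one_mul, mul_one, map_add, e1, add_zero, map_sub, map_add, e2,
    add_zero, PowerSeries.coeff_monomial] at h
  rw [h]
  split_ifs with hik
  · subst hik; simp [oscPart]
  · simp

variable (m : ℕ) (A₀ : Matrix (Fin n) (Fin n) ℂ) (B : ℤ → Matrix (Fin n) (Fin n) ℂ)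

theorem coeff_kbSystem {N k : ℕ} (hk : k < N) :
    PowerSeries.coeff k (kbSystem m A₀ B N) = LaurentPolynomial.C (avgCoeff m A₀ B k) := by
  induction N with
  | zero => omega
  | succ N ih =>
    rcases Nat.eq_or_lt_of_le (Nat.lt_succ_iff.1 hk) with h | h
    · subst h
      rw [avgCoeff, kbSystem, coeff_kbStep le_rfl, if_pos rfl]
      rw [meanValue, meanValue, ← LaurentPolynomial.single_eq_C]
      simp
    · rw [kbSystem, coeff_kbStep h.le, if_neg h.ne, ih h]

/-- The coefficient matrix of `x` in the system, as a function of `ω` and `τ = ω t`. -/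
def coeffMatrix (x : ℝ × ℝ) : Matrix (Fin n) (Fin n) ℂ :=
  trigEval x.2 (LaurentPolynomial.C A₀
      + ∑ l ∈ harmonics m, LaurentPolynomial.C (B l) * LaurentPolynomial.T l)
    + x.1⁻¹ • B 0

/-- The truncation `∑_{k < N} ω⁻ᵏ A_k` of the formal averaged system. -/
def avgTrunc (N : ℕ) (ω : ℝ) : Matrix (Fin n) (Fin n) ℂ :=
  ∑ k ∈ Finset.range N, ω⁻¹ ^ k • avgCoeff m A₀ B k

section Averaging

open Asymptotics
open scoped Matrix.Norms.Operator

theorem norm_exp_I_mul_int (l : ℤ) (τ : ℝ) : ‖Complex.exp (Complex.I * l * τ)‖ = 1 := by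
  rw [Complex.norm_exp]; simp

theorem norm_trigEval_le (τ : ℝ) (V : TrigPoly n) :
    ‖trigEval τ V‖ ≤ ∑ l ∈ V.coeff.support, ‖V.coeff l‖ := by
  rw [trigEval_eq_sum]
  refine (norm_sum_le _ _).trans (Finset.sum_le_sum fun l _ => ?_)
  rw [norm_smul, norm_exp_I_mul_int, one_mul]

theorem hasDerivAt_trigEval_zeroMeanPrimitive (V : TrigPoly n) (ω t : ℝ) :
    HasDerivAt (fun t : ℝ => trigEval (ω * t) (zeroMeanPrimitive V))
      (ω • trigEval (ω * t) (oscPart V)) t := by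
  simp only [trigEval_oscPart, zeroMeanPrimitive, map_sum, trigEval_C_mul_T, Finset.smul_sum]
  apply HasDerivAt.fun_sum
  intro l hl
  have hl0 : (l : ℂ) ≠ 0 := by exact_mod_cast (Finset.mem_erase.1 hl).1
  have h1 : HasDerivAt (fun t : ℝ => Complex.I * l * ((ω * t : ℝ) : ℂ)) (Complex.I * l * ω) t := by
    have := ((hasDerivAt_id t).const_mul ω).ofReal_comp.const_mul (Complex.I * l)
    simpa using this
  have h2 := h1.cexp.smul_const ((Complex.I * l : ℂ)⁻¹ • V.coeff l)
  convert h2 using 1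
  rw [smul_smul, ← Complex.coe_smul, smul_smul]
  congr 1
  field_simp [Complex.I_ne_zero]

/-- The filter `ω → ∞`, uniformly in the fast time `τ`. -/
abbrev fastFilter : Filter (ℝ × ℝ) := atTop ×ˢ ⊤

/-- Expansions in powers of `ω⁻¹`, uniform in `τ`, of matrix functions of `(ω, τ)`. -/
abbrev HasTrigExpansion (N : ℕ) (f : ℝ × ℝ → Matrix (Fin n) (Fin n) ℂ)
    (F : PowerSeries (TrigPoly n)) : Prop :=
  HasExpansion fastFilter (fun x => x.1⁻¹) (fun x => trigEval x.2) N f F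

theorem isBigO_inv_fastFilter :
    (fun x : ℝ × ℝ => x.1⁻¹) =O[fastFilter] fun _ => (1 : ℝ) :=
  ((tendsto_inv_atTop_zero.comp tendsto_fst).isBigO_one ℝ)

theorem isBigO_trigEval (V : TrigPoly n) :
    (fun x : ℝ × ℝ => trigEval x.2 V) =O[fastFilter] fun _ => (1 : ℝ) := by
  apply IsBigO.of_bound (∑ l ∈ V.coeff.support, ‖V.coeff l‖)
  filter_upwards with x
  simpa using norm_trigEval_le x.2 V

theorem hasTrigExpansion_coeffMatrix (N : ℕ) :
    HasTrigExpansion N (coeffMatrix m A₀ B) (initialSystem m A₀ B) := by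
  have h := (hasExpansion_monomial (N := N) isBigO_inv_fastFilter isBigO_trigEval 0
    (LaurentPolynomial.C A₀
      + ∑ l ∈ harmonics m, LaurentPolynomial.C (B l) * LaurentPolynomial.T l)).add
    (hasExpansion_monomial (N := N) isBigO_inv_fastFilter isBigO_trigEval 1
      (LaurentPolynomial.C (B 0)))
  convert h using 1
  · funext x
    simp [coeffMatrix, trigEval_C]
  · rfl

/-- The product of the first `j` changes of variables, as an actual function `q` of `(ω, τ)` with
time derivative `q'` along `τ = ω t`, intertwines the initial system and the `j`-th one to all
orders. -/
theorem exists_kbTransform (j : ℕ) : ∃ (q q' : ℝ × ℝ → Matrix (Fin n) (Fin n) ℂ)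
    (Q : PowerSeries (TrigPoly n)),
    (∀ ω : ℝ, ω ≠ 0 → ∀ t : ℝ, HasDerivAt (fun t => q (ω, ω * t)) (q' (ω, ω * t)) t) ∧
    (∀ N, HasTrigExpansion N q Q) ∧
    (∀ N, HasTrigExpansion N q' (initialSystem m A₀ B * Q - Q * kbSystem m A₀ B j)) ∧
    PowerSeries.coeff 0 Q = 1 ∧
    (∀ ω τ : ℝ, q (ω, τ + 2 * Real.pi) = q (ω, τ)) := by
  induction j with
  | zero =>
    refine ⟨1, 0, 1, fun ω _ t => hasDerivAt_const _ _,
      fun N => hasExpansion_one isBigO_inv_fastFilter isBigO_trigEval, fun N => ?_, by simp,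
      fun _ _ => rfl⟩
    rw [kbSystem, mul_one, one_mul, sub_self]
    exact (expansionSubring isBigO_inv_fastFilter isBigO_trigEval N).zero_mem
  | succ j ih =>
    obtain ⟨q, q', Q, h1, h2, h3, h4, h5⟩ := ih
    set S := kbSystem m A₀ B j
    set U := zeroMeanPrimitive (PowerSeries.coeff j S) with hU
    set V := oscPart (PowerSeries.coeff j S) with hV
    set p : ℝ × ℝ → Matrix (Fin n) (Fin n) ℂ :=
      1 + fun x => x.1⁻¹ ^ (j + 1) • trigEval x.2 U with hp
    set p' : ℝ × ℝ → Matrix (Fin n) (Fin n) ℂ := fun x => x.1⁻¹ ^ j • trigEval x.2 V with hp'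
    have hpE : ∀ N, HasTrigExpansion N p (kbChange j S) := fun N =>
      (hasExpansion_one isBigO_inv_fastFilter isBigO_trigEval).add
        (hasExpansion_monomial isBigO_inv_fastFilter isBigO_trigEval (j + 1) U)
    have hpE' : ∀ N, HasTrigExpansion N p' (PowerSeries.monomial j V) := fun N =>
      hasExpansion_monomial isBigO_inv_fastFilter isBigO_trigEval j V
    refine ⟨q * p, q' * p + q * p', Q * kbChange j S, fun ω hω t => ?_, fun N =>
      (h2 N).mul isBigO_inv_fastFilter isBigO_trigEval (hpE N), fun N => ?_, ?_, fun ω τ => ?_⟩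
    · have hpd : HasDerivAt (fun t => p (ω, ω * t)) (p' (ω, ω * t)) t := by
        have := ((hasDerivAt_trigEval_zeroMeanPrimitive (PowerSeries.coeff j S) ω t).const_smul
          (ω⁻¹ ^ (j + 1))).const_add 1
        refine this.congr_deriv ?_
        change _ = ω⁻¹ ^ j • trigEval (ω * t) V
        rw [smul_smul, pow_succ, mul_assoc, inv_mul_cancel₀ hω, mul_one]
      exact (h1 ω hω t).mul hpd
    · have := ((h3 N).mul isBigO_inv_fastFilter isBigO_trigEval (hpE N)).add
        ((h2 N).mul isBigO_inv_fastFilter isBigO_trigEval (hpE' N))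
      convert this using 1
      exact intertwine_comp (kbChange_mul_kbStep j S)
    · rw [kbChange, mul_add, mul_one, map_add, h4, PowerSeries.coeff_mul]
      simp [PowerSeries.coeff_monomial]
    · simp only [Pi.mul_apply, h5, hp, Pi.add_apply, trigEval_add_two_pi]
      rfl

/-- A periodic near-identity change of variables which reduces the homogeneous system to the
truncated averaged system with an error `O(ω^{-N})`. -/
theorem exists_averaging_transform (N : ℕ) : ∃ q q' : ℝ × ℝ → Matrix (Fin n) (Fin n) ℂ,
    (∀ ω : ℝ, ω ≠ 0 → ∀ t : ℝ, HasDerivAt (fun t => q (ω, ω * t)) (q' (ω, ω * t)) t) ∧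
    (∀ ω τ : ℝ, q (ω, τ + 2 * Real.pi) = q (ω, τ)) ∧
    (fun x => q x - 1) =O[fastFilter] (fun x => x.1⁻¹) ∧
    (fun x => q' x - (coeffMatrix m A₀ B x * q x - q x * avgTrunc m A₀ B N x.1))
      =O[fastFilter] fun x => x.1⁻¹ ^ N := by
  obtain ⟨q, q', Q, h1, h2, h3, h4, h5⟩ := exists_kbTransform m A₀ B N
  refine ⟨q, q', h1, h5, ?_, ?_⟩
  · have := h2 1
    simpa [HasExpansion, h4] using this
  · have hT : HasTrigExpansion N (fun x => avgTrunc m A₀ B N x.1) (kbSystem m A₀ B N) := by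
      refine (isBigO_zero (E' := Matrix (Fin n) (Fin n) ℂ) _ _).congr_left fun x => ?_
      refine (sub_eq_zero.2 ?_).symm
      refine Finset.sum_congr rfl fun k hk => ?_
      rw [coeff_kbSystem m A₀ B (Finset.mem_range.1 hk), trigEval_C]
    have := (h3 N).sub (((hasTrigExpansion_coeffMatrix m A₀ B N).mul isBigO_inv_fastFilter
      isBigO_trigEval (h2 N)).sub ((h2 N).mul isBigO_inv_fastFilter isBigO_trigEval hT))
    rw [sub_self] at this
    simpa [HasExpansion] using this

end Averaging

/-! ### Linear differential equations with bounded coefficients -/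

section LinearODE

variable {E : Type*} [NormedAddCommGroup E] [NormedSpace ℝ E]

/-- The Picard iterates of `x' = A x`, `x 0 = x₀`, taken as the terms of the Dyson series. -/
def dysonTerm (A : ℝ → E →L[ℝ] E) (x₀ : E) : ℕ → ℝ → E
  | 0 => fun _ => x₀
  | k + 1 => fun t => ∫ s in (0 : ℝ)..t, A s (dysonTerm A x₀ k s)

variable {A : ℝ → E →L[ℝ] E} {K : ℝ}

theorem hasDerivAt_dysonTerm_succ [CompleteSpace E] (hA : Continuous A) (x₀ : E) (k : ℕ) :
    Continuous (dysonTerm A x₀ k) ∧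
    ∀ t, HasDerivAt (dysonTerm A x₀ (k + 1)) (A t (dysonTerm A x₀ k t)) t := by
  have step : ∀ k, Continuous (dysonTerm A x₀ k) →
      ∀ t, HasDerivAt (dysonTerm A x₀ (k + 1)) (A t (dysonTerm A x₀ k t)) t := by
    intro k hk t
    exact ((hA.clm_apply hk).integral_hasStrictDerivAt 0 t).hasDerivAt
  have hc : Continuous (dysonTerm A x₀ k) := by
    induction k with
    | zero => exact continuous_const
    | succ k ih => exact continuous_iff_continuousAt.2 fun t => (step k ih t).continuousAt
  exact ⟨hc, step k hc⟩

theorem norm_dysonTerm_le [CompleteSpace E] (hA : Continuous A) (hK : ∀ t, ‖A t‖ ≤ K) (x₀ : E)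
    (k : ℕ) (t : ℝ) :
    ‖dysonTerm A x₀ k t‖ ≤ ‖x₀‖ * ((K * |t|) ^ k / (k.factorial : ℝ)) := by
  have hK0 : 0 ≤ K := (norm_nonneg _).trans (hK 0)
  induction k generalizing t with
  | zero => simp [dysonTerm]
  | succ k ih =>
    have hc := (hasDerivAt_dysonTerm_succ hA x₀ k).1
    calc ‖dysonTerm A x₀ (k + 1) t‖
        ≤ ∫ s in Set.uIoc 0 t, ‖A s (dysonTerm A x₀ k s)‖ :=
          intervalIntegral.norm_integral_le_integral_norm_uIoc
      _ ≤ ∫ s in Set.uIoc 0 t, K * (‖x₀‖ * (K ^ k / (k.factorial : ℝ))) * |s - 0| ^ k := by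
          apply MeasureTheory.integral_mono
          · exact ((hA.clm_apply hc).norm.intervalIntegrable 0 t).def'
          · apply IntervalIntegrable.def'
            apply Continuous.intervalIntegrable
            fun_prop
          · intro s
            refine ((A s).le_opNorm _).trans ?_
            refine (mul_le_mul (hK s) (ih s) (norm_nonneg _) hK0).trans (le_of_eq ?_)
            simp only [mul_pow, sub_zero]; ring
      _ = ‖x₀‖ * ((K * |t|) ^ (k + 1) / ((k + 1).factorial : ℝ)) := by
          rw [MeasureTheory.integral_const_mul, integral_pow_abs_sub_uIoc, Nat.factorial_succ]
          push_cast
          rw [sub_zero, mul_pow]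
          field_simp
          ring

theorem exists_linear_solution [CompleteSpace E] (hA : Continuous A) (hK : ∀ t, ‖A t‖ ≤ K)
    (x₀ : E) : ∃ x : ℝ → E, x 0 = x₀ ∧ (∀ t, HasDerivAt x (A t (x t)) t) ∧
      ∀ t, ‖x t‖ ≤ ‖x₀‖ * Real.exp (K * |t|) := by
  have hK0 : 0 ≤ K := (norm_nonneg _).trans (hK 0)
  have hsum : ∀ c : ℝ, Summable fun k : ℕ => ‖x₀‖ * (c ^ k / (k.factorial : ℝ)) :=
    fun c => (Real.summable_pow_div_factorial c).mul_left _
  have hs : ∀ t, Summable fun k => dysonTerm A x₀ k t := fun t =>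
    Summable.of_norm_bounded (hsum _) fun k => norm_dysonTerm_le hA hK x₀ k t
  refine ⟨fun t => ∑' k, dysonTerm A x₀ k t, ?_, fun t => ?_, fun t => ?_⟩
  · change ∑' k, dysonTerm A x₀ k 0 = x₀
    rw [tsum_eq_single 0]
    · rfl
    · intro k hk
      obtain ⟨k, rfl⟩ := Nat.exists_eq_succ_of_ne_zero hk
      simp [dysonTerm]
  · have hbound : ∀ k, ∀ y ∈ Metric.ball (0 : ℝ) (|t| + 1), ‖A y (dysonTerm A x₀ k y)‖
        ≤ K * (‖x₀‖ * ((K * (|t| + 1)) ^ k / (k.factorial : ℝ))) := by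
      intro k y hy
      refine ((A y).le_opNorm _).trans ?_
      refine mul_le_mul (hK y) ((norm_dysonTerm_le hA hK x₀ k y).trans ?_) (norm_nonneg _) hK0
      have : |y| ≤ |t| + 1 := by simpa using (mem_ball_zero_iff.1 hy).le
      gcongr
    have htb : t ∈ Metric.ball (0 : ℝ) (|t| + 1) := by simp
    have hder : HasDerivAt (fun z => ∑' k, dysonTerm A x₀ (k + 1) z)
        (∑' k, A t (dysonTerm A x₀ k t)) t :=
      hasDerivAt_tsum_of_isPreconnected (g := fun k => dysonTerm A x₀ (k + 1))
        (g' := fun k y => A y (dysonTerm A x₀ k y)) ((hsum _).mul_left K) Metric.isOpen_ball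
        (convex_ball _ _).isPreconnected (fun k y _ => (hasDerivAt_dysonTerm_succ hA x₀ k).2 y)
        hbound htb ((summable_nat_add_iff (f := fun k => dysonTerm A x₀ k t) 1).2 (hs t)) htb
    have e1 : (fun z => ∑' k, dysonTerm A x₀ k z)
        = fun z => x₀ + ∑' k, dysonTerm A x₀ (k + 1) z := by
      funext z
      rw [(hs z).tsum_eq_zero_add]; rfl
    change HasDerivAt (fun z => ∑' k, dysonTerm A x₀ k z) (A t (∑' k, dysonTerm A x₀ k t)) t
    have e2 : A t (∑' k, dysonTerm A x₀ k t) = ∑' k, A t (dysonTerm A x₀ k t) :=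
      (A t).map_tsum (hs t)
    rw [e2, e1]
    exact hder.const_add x₀
  · have h : HasSum (fun k : ℕ => ‖x₀‖ * ((K * |t|) ^ k / (k.factorial : ℝ)))
        (‖x₀‖ * Real.exp (K * |t|)) := by
      rw [Real.exp_eq_exp_ℝ]
      exact (NormedSpace.expSeries_div_hasSum_exp (K * |t|)).mul_left _
    exact tsum_of_norm_bounded h fun k => norm_dysonTerm_le hA hK x₀ k t

end LinearODE

/-! ### Floquet theory -/

section Floquet

open scoped Matrix.Norms.Operator

variable {n : ℕ}

/-- `Φ` is the fundamental matrix of `x' = A x` normalised at time zero, `Ψ` is its inverse, and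
both grow at most like `exp (K |t|)`. -/
structure IsFundamental (A : ℝ → Matrix (Fin n) (Fin n) ℂ) (K : ℝ)
    (Φ Ψ : ℝ → Matrix (Fin n) (Fin n) ℂ) : Prop where
  left_zero : Φ 0 = 1
  right_zero : Ψ 0 = 1
  hasDerivAt_left : ∀ t, HasDerivAt Φ (A t * Φ t) t
  hasDerivAt_right : ∀ t, HasDerivAt Ψ (-(Ψ t * A t)) t
  right_mul_left : ∀ t, Ψ t * Φ t = 1
  left_mul_right : ∀ t, Φ t * Ψ t = 1
  norm_left_le : ∀ t, ‖Φ t‖ ≤ ‖(1 : Matrix (Fin n) (Fin n) ℂ)‖ * Real.exp (K * |t|)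
  norm_right_le : ∀ t, ‖Ψ t‖ ≤ ‖(1 : Matrix (Fin n) (Fin n) ℂ)‖ * Real.exp (K * |t|)

theorem eq_of_hasDerivWithinAt_zero {E : Type*} [NormedAddCommGroup E] [NormedSpace ℝ E]
    {f : ℝ → E} {s : Set ℝ} (hs : Convex ℝ s) (hf : ∀ t ∈ s, HasDerivWithinAt f 0 s t)
    {a b : ℝ} (ha : a ∈ s) (hb : b ∈ s) : f a = f b := by
  have := hs.norm_image_sub_le_of_norm_hasDerivWithin_le (f' := fun _ => 0) (C := 0) hf
    (by simp) hb ha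
  rw [zero_mul] at this
  exact sub_eq_zero.1 (norm_le_zero_iff.1 this)

theorem exists_isFundamental {A : ℝ → Matrix (Fin n) (Fin n) ℂ} {K : ℝ} (hA : Continuous A)
    (hK : ∀ t, ‖A t‖ ≤ K) : ∃ Φ Ψ, IsFundamental A K Φ Ψ := by
  obtain ⟨Φ, h1, h2, h3⟩ := exists_linear_solution
    (A := fun t => ContinuousLinearMap.mul ℝ (Matrix (Fin n) (Fin n) ℂ) (A t)) (K := K)
    (by fun_prop) (fun t => (ContinuousLinearMap.opNorm_mul_apply_le ℝ _ _).trans (hK t)) 1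
  obtain ⟨Ψ, k1, k2, k3⟩ := exists_linear_solution
    (A := fun t => (ContinuousLinearMap.mul ℝ (Matrix (Fin n) (Fin n) ℂ)).flip (-A t)) (K := K)
    (by fun_prop) (fun t => by
      refine ContinuousLinearMap.opNorm_le_bound _ ((norm_nonneg _).trans (hK 0)) fun x => ?_
      simp only [ContinuousLinearMap.flip_apply, ContinuousLinearMap.mul_apply']
      refine (norm_mul_le _ _).trans ?_
      rw [norm_neg, mul_comm]
      gcongr; exact hK t) 1
  simp only [ContinuousLinearMap.flip_apply, ContinuousLinearMap.mul_apply', mul_neg] at h2 k2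
  have h4 : ∀ t, Ψ t * Φ t = 1 := by
    intro t
    have : Ψ t * Φ t = Ψ 0 * Φ 0 :=
      eq_of_hasDerivWithinAt_zero (f := fun t => Ψ t * Φ t) convex_univ (fun s _ => by
        have := ((k2 s).mul (h2 s)).hasDerivWithinAt (s := Set.univ)
        refine this.congr_deriv ?_
        noncomm_ring) (Set.mem_univ t) (Set.mem_univ 0)
    rw [this, h1, k1, one_mul]
  exact ⟨Φ, Ψ, h1, k1, h2, k2, h4, fun t => mul_eq_one_comm.1 (h4 t), h3, k3⟩

/-- The bilinear map `(M, v) ↦ M v`, as a continuous one. -/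
def mulVecL (n : ℕ) : Matrix (Fin n) (Fin n) ℂ →L[ℝ] (Fin n → ℂ) →L[ℝ] (Fin n → ℂ) :=
  LinearMap.mkContinuous₂ (Matrix.mulVecBilin ℝ ℝ) 1 fun M v => by
    simpa using Matrix.linfty_opNorm_mulVec M v

theorem hasDerivWithinAt_mulVec {M : ℝ → Matrix (Fin n) (Fin n) ℂ} {w : ℝ → Fin n → ℂ}
    {M' : Matrix (Fin n) (Fin n) ℂ} {w' : Fin n → ℂ} {s : Set ℝ} {t : ℝ}
    (hM : HasDerivWithinAt M M' s t) (hw : HasDerivWithinAt w w' s t) :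
    HasDerivWithinAt (fun t => M t *ᵥ w t) (M t *ᵥ w' + M' *ᵥ w t) s t :=
  (mulVecL n).hasDerivWithinAt_of_bilinear hM hw

namespace IsFundamental

variable {A Φ Ψ : ℝ → Matrix (Fin n) (Fin n) ℂ} {K T : ℝ} {f : ℝ → Fin n → ℂ}

theorem eq_mulVec (h : IsFundamental A K Φ Ψ) {s : Set ℝ} (hs : Convex ℝ s) {w : ℝ → Fin n → ℂ}
    (hw : ∀ t ∈ s, HasDerivWithinAt w (A t *ᵥ w t) s t) {a t : ℝ} (ha : a ∈ s) (ht : t ∈ s) :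
    w t = Φ t *ᵥ (Ψ a *ᵥ w a) := by
  have := eq_of_hasDerivWithinAt_zero (f := fun t => Ψ t *ᵥ w t) hs (fun r hr => by
    refine (hasDerivWithinAt_mulVec (h.hasDerivAt_right r).hasDerivWithinAt
      (hw r hr)).congr_deriv ?_
    rw [Matrix.neg_mulVec, Matrix.mulVec_mulVec, add_neg_cancel]) ha ht
  rw [this, Matrix.mulVec_mulVec, h.left_mul_right, Matrix.one_mulVec]

theorem eq_mulVec_zero (h : IsFundamental A K Φ Ψ) {w : ℝ → Fin n → ℂ}
    (hw : ∀ t, HasDerivAt w (A t *ᵥ w t) t) (t : ℝ) : w t = Φ t *ᵥ w 0 := by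
  have := h.eq_mulVec convex_univ (fun t _ => (hw t).hasDerivWithinAt) (Set.mem_univ 0)
    (Set.mem_univ t)
  rwa [h.right_zero, Matrix.one_mulVec] at this

theorem eq_mul_of_hasDerivAt (h : IsFundamental A K Φ Ψ) {X : ℝ → Matrix (Fin n) (Fin n) ℂ}
    (hX : ∀ t, HasDerivAt X (A t * X t) t) (t : ℝ) : X t = Φ t * X 0 := by
  have := eq_of_hasDerivWithinAt_zero (f := fun t => Ψ t * X t) convex_univ (fun r _ => by
    refine ((h.hasDerivAt_right r).mul (hX r)).hasDerivWithinAt.congr_deriv ?_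
    noncomm_ring) (Set.mem_univ t) (Set.mem_univ 0)
  rw [h.right_zero, one_mul] at this
  rw [← this, ← mul_assoc, h.left_mul_right, one_mul]

theorem add_period (h : IsFundamental A K Φ Ψ) (hT : Function.Periodic A T) (t : ℝ) :
    Φ (t + T) = Φ t * Φ T := by
  have := h.eq_mul_of_hasDerivAt (X := fun t => Φ (t + T)) (fun t => by
    have := (h.hasDerivAt_left (t + T)).comp_add_const t T
    rwa [hT t] at this) t
  simpa using this

theorem add_nsmul_period (h : IsFundamental A K Φ Ψ) (hT : Function.Periodic A T) (t : ℝ)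
    (k : ℕ) : Φ (t + k * T) = Φ t * Φ T ^ k := by
  induction k with
  | zero => simp
  | succ k ih =>
    rw [pow_succ, ← mul_assoc, ← ih, ← h.add_period hT]
    congr 1; push_cast; ring

theorem sub_solution {x y : ℝ → Fin n → ℂ} {s : Set ℝ}
    (hx : IsIntegralCurveOn x (fun t x => A t *ᵥ x + f t) s)
    (hy : IsIntegralCurveOn y (fun t x => A t *ᵥ x + f t) s) :
    ∀ t ∈ s, HasDerivWithinAt (fun t => x t - y t) (A t *ᵥ (x t - y t)) s t := by
  intro t ht
  refine ((hx t ht).sub (hy t ht)).congr_deriv ?_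
  rw [Matrix.mulVec_sub, add_sub_add_right_eq_sub]

/-- If `1` is not a Floquet multiplier, the inhomogeneous system has a unique periodic solution. -/
theorem existsUnique_periodic (h : IsFundamental A K Φ Ψ) (hT : Function.Periodic A T)
    (hf : Continuous f) (hfT : Function.Periodic f T)
    (h1 : ∀ v : Fin n → ℂ, Φ T *ᵥ v = v → v = 0) :
    ∃ x : ℝ → Fin n → ℂ,
      (IsIntegralCurve x (fun t x => A t *ᵥ x + f t) ∧ Function.Periodic x T) ∧
      ∀ z, (IsIntegralCurve z (fun t x => A t *ᵥ x + f t) ∧ Function.Periodic z T) → z = x := by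
  have hΨ : Continuous Ψ := continuous_iff_continuousAt.2 fun t => (h.hasDerivAt_right t).continuousAt
  set F : ℝ → Fin n → ℂ := fun t => ∫ s in (0 : ℝ)..t, Ψ s *ᵥ f s with hF
  have hc : Continuous fun s => Ψ s *ᵥ f s := hΨ.matrix_mulVec hf
  have hFd : ∀ t, HasDerivAt F (Ψ t *ᵥ f t) t := fun t =>
    (hc.integral_hasStrictDerivAt 0 t).hasDerivAt
  have hinj : Function.Injective ((1 - Φ T).mulVecLin) := by
    rw [← LinearMap.ker_eq_bot, LinearMap.ker_eq_bot']
    intro v hv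
    rw [Matrix.mulVecLin_apply, Matrix.sub_mulVec, Matrix.one_mulVec, sub_eq_zero] at hv
    exact h1 v hv.symm
  obtain ⟨x₀, hx₀⟩ := LinearMap.injective_iff_surjective.1 hinj (Φ T *ᵥ F T)
  rw [Matrix.mulVecLin_apply, Matrix.sub_mulVec, Matrix.one_mulVec] at hx₀
  have hx : IsIntegralCurve (fun t => Φ t *ᵥ (x₀ + F t)) (fun t x => A t *ᵥ x + f t) := by
    intro t
    have := hasDerivWithinAt_mulVec (h.hasDerivAt_left t).hasDerivWithinAt
      (((hFd t).const_add x₀).hasDerivWithinAt (s := Set.univ))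
    rw [hasDerivWithinAt_univ] at this
    refine this.congr_deriv ?_
    simp only [Matrix.mulVec_mulVec, h.left_mul_right, Matrix.one_mulVec]
    rw [add_comm]
  refine ⟨_, ⟨hx, fun t => ?_⟩, fun z hz => ?_⟩
  · have hxT : IsIntegralCurve (fun t => Φ (t + T) *ᵥ (x₀ + F (t + T)))
        (fun t x => A t *ᵥ x + f t) := by
      intro t
      have := (hx (t + T)).comp_add_const t T
      simpa only [hT t, hfT t] using this
    have := h.eq_mulVec_zero (fun t => by
      have := sub_solution (hxT.isIntegralCurveOn Set.univ) (hx.isIntegralCurveOn Set.univ) t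
        (Set.mem_univ t)
      rwa [hasDerivWithinAt_univ] at this) t
    have h0 : Φ (0 + T) *ᵥ (x₀ + F (0 + T)) - Φ 0 *ᵥ (x₀ + F 0) = 0 := by
      rw [h.left_zero, Matrix.one_mulVec, zero_add, Matrix.mulVec_add, ← hx₀]
      simp [hF]
    rw [h0, Matrix.mulVec_zero] at this
    exact sub_eq_zero.1 this
  · have hw := h.eq_mulVec_zero (fun t => by
      have := sub_solution (hz.1.isIntegralCurveOn Set.univ) (hx.isIntegralCurveOn Set.univ) t
        (Set.mem_univ t)
      rwa [hasDerivWithinAt_univ] at this)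
    have hTT := hw T
    have e1 : z T = z 0 := by simpa using hz.2 0
    have e2 : Φ T *ᵥ (x₀ + F T) = Φ 0 *ᵥ (x₀ + F 0) := by
      rw [h.left_zero, Matrix.one_mulVec, Matrix.mulVec_add, ← hx₀]
      simp [hF]
    rw [e1, e2] at hTT
    have h0 := h1 _ hTT.symm
    funext t
    have := hw t
    rw [h0, Matrix.mulVec_zero] at this
    exact sub_eq_zero.1 this

/-- If the powers of the monodromy matrix are bounded, every solution of the inhomogeneous system is
stable. -/
theorem isLyapunovStable (h : IsFundamental A K Φ Ψ) (hT : Function.Periodic A T) (hT0 : 0 < T)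
    (hK : 0 ≤ K) {C : ℝ} (hC : ∀ k : ℕ, ‖Φ T ^ k‖ ≤ C) {x : ℝ → Fin n → ℂ}
    (hx : IsIntegralCurve x (fun t x => A t *ᵥ x + f t)) :
    IsLyapunovStable (fun t x => A t *ᵥ x + f t) x := by
  intro t₀ ε hε
  have hC0 : 0 ≤ C := (norm_nonneg _).trans (hC 0)
  set c₁ := ‖(1 : Matrix (Fin n) (Fin n) ℂ)‖ * Real.exp (K * (|t₀| + T)) * C with hc₁
  have hc₁0 : 0 ≤ c₁ := by positivity
  have hΦ : ∀ t ≥ t₀, ‖Φ t‖ ≤ c₁ := by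
    intro t ht
    set k := ⌊(t - t₀) / T⌋₊ with hk
    have hk1 : (k : ℝ) * T ≤ t - t₀ := by
      have := Nat.floor_le (div_nonneg (sub_nonneg.2 ht) hT0.le)
      rwa [le_div_iff₀ hT0] at this
    have hk2 : t - t₀ ≤ (k : ℝ) * T + T := by
      have := (Nat.lt_floor_add_one ((t - t₀) / T)).le
      rw [div_le_iff₀ hT0] at this
      linarith
    have e : t = (t - k * T) + k * T := by ring
    rw [e, h.add_nsmul_period hT]
    refine (norm_mul_le _ _).trans (mul_le_mul ?_ (hC k) (norm_nonneg _) (by positivity))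
    refine (h.norm_left_le _).trans ?_
    gcongr
    have e2 : t - k * T = t₀ + (t - t₀ - k * T) := by ring
    rw [e2]
    refine (abs_add_le _ _).trans ?_
    gcongr
    rw [abs_of_nonneg (by linarith)]; linarith
  refine ⟨ε / (c₁ * ‖Ψ t₀‖ + 1), by positivity, fun z hz hzx t ht => ?_⟩
  have hw := h.eq_mulVec (convex_Ici t₀) (sub_solution hz (hx.isIntegralCurveOn _))
    (Set.mem_Ici.2 le_rfl) (Set.mem_Ici.2 ht)
  rw [hw]
  calc ‖Φ t *ᵥ (Ψ t₀ *ᵥ (z t₀ - x t₀))‖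
      ≤ ‖Φ t‖ * (‖Ψ t₀‖ * ‖z t₀ - x t₀‖) :=
        (Matrix.linfty_opNorm_mulVec _ _).trans
          (mul_le_mul_of_nonneg_left (Matrix.linfty_opNorm_mulVec _ _) (norm_nonneg _))
    _ ≤ c₁ * (‖Ψ t₀‖ * ‖z t₀ - x t₀‖) := by gcongr; exact hΦ t ht
    _ = (c₁ * ‖Ψ t₀‖) * ‖z t₀ - x t₀‖ := by ring
    _ ≤ (c₁ * ‖Ψ t₀‖ + 1) * ‖z t₀ - x t₀‖ := by gcongr; linarith
    _ < ε := by rw [lt_div_iff₀ (by positivity)] at hzx; linarith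

/-- A Floquet multiplier outside the closed unit disc makes every solution of the inhomogeneous
system unstable. -/
theorem not_isLyapunovStable (h : IsFundamental A K Φ Ψ) (hT : Function.Periodic A T)
    (hT0 : 0 < T) {μ : ℂ} (hμ : 1 < ‖μ‖) {v : Fin n → ℂ} (hv : v ≠ 0) (hΦ : Φ T *ᵥ v = μ • v)
    {x : ℝ → Fin n → ℂ} (hx : IsIntegralCurve x (fun t x => A t *ᵥ x + f t)) :
    ¬ IsLyapunovStable (fun t x => A t *ᵥ x + f t) x := by
  intro hst
  obtain ⟨δ, hδ, hst⟩ := hst 0 1 one_pos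
  have hvpos : 0 < ‖v‖ := norm_pos_iff.2 hv
  set c : ℝ := δ / (2 * ‖v‖) with hc
  have hcpos : 0 < c := by positivity
  have hz : IsIntegralCurve (fun t => x t + Φ t *ᵥ (c • v)) (fun t x => A t *ᵥ x + f t) := by
    intro t
    have := hasDerivWithinAt_mulVec (h.hasDerivAt_left t).hasDerivWithinAt
      (hasDerivWithinAt_const t Set.univ (c • v))
    rw [hasDerivWithinAt_univ] at this
    refine ((hx t).add this).congr_deriv ?_
    simp only [Matrix.mulVec_zero, Matrix.mulVec_add, Matrix.mulVec_mulVec]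
    abel
  have hpow : ∀ k : ℕ, Φ T ^ k *ᵥ v = μ ^ k • v := by
    intro k
    induction k with
    | zero => simp
    | succ k ih =>
      rw [pow_succ, ← Matrix.mulVec_mulVec, hΦ, Matrix.mulVec_smul, ih, smul_smul, pow_succ,
        mul_comm]
  have hbound := hst _ (hz.isIntegralCurveOn _) (by
    rw [h.left_zero, Matrix.one_mulVec, add_sub_cancel_left, norm_smul, Real.norm_of_nonneg
      hcpos.le, hc]
    field_simp; linarith)
  obtain ⟨k, hk⟩ := pow_unbounded_of_one_lt (1 / (c * ‖v‖)) hμ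
  have := hbound (0 + k * T) (by positivity)
  rw [add_sub_cancel_left, h.add_nsmul_period hT, h.left_zero, one_mul, Matrix.mulVec_smul, hpow,
    norm_smul, norm_smul, norm_pow, Real.norm_of_nonneg hcpos.le] at this
  rw [div_lt_iff₀ (by positivity)] at hk
  nlinarith

end IsFundamental

end Floquet

/-! ### Exponentials and logarithms of matrices -/

section MatrixExp

open scoped Matrix.Norms.Operator Topology

variable {n : ℕ}

/-- The exponential is bi-Lipschitz near zero and covers a neighbourhood of the identity. -/
theorem exists_log (𝔸 : Type*) [NormedRing 𝔸] [NormedAlgebra ℂ 𝔸] [CompleteSpace 𝔸] :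
    ∃ r > 0, ∃ δ > 0,
    (∀ X Y : 𝔸, ‖X‖ < r → ‖Y‖ < r →
      ‖X - Y‖ ≤ 2 * ‖NormedSpace.exp X - NormedSpace.exp Y‖) ∧
    ∀ M : 𝔸, ‖M - 1‖ < δ → ∃ X, ‖X‖ < r ∧ NormedSpace.exp X = M := by
  have hd : HasStrictFDerivAt (NormedSpace.exp : 𝔸 → 𝔸)
      ((ContinuousLinearEquiv.refl ℂ 𝔸 : 𝔸 ≃L[ℂ] 𝔸) : 𝔸 →L[ℂ] 𝔸) 0 :=
    hasStrictFDerivAt_exp_zero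
  obtain ⟨s, hs, happ⟩ := hd.approximates_deriv_on_nhds (c := 1 / 2) (Or.inr (by norm_num))
  obtain ⟨r, hr, hrs⟩ := Metric.mem_nhds_iff.1 hs
  have himg : NormedSpace.exp '' Metric.ball (0 : 𝔸) r ∈ 𝓝 (1 : 𝔸) := by
    let : NormedAlgebra ℚ 𝔸 := .restrictScalars ℚ ℂ 𝔸
    have := hd.map_nhds_eq_of_equiv
    rw [NormedSpace.exp_zero] at this
    rw [← this]
    exact image_mem_map (Metric.ball_mem_nhds _ hr)
  obtain ⟨δ, hδ, hδs⟩ := Metric.mem_nhds_iff.1 himg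
  refine ⟨r, hr, δ, hδ, fun X Y hX hY => ?_, fun M hM => ?_⟩
  · have h3 : ‖NormedSpace.exp X - NormedSpace.exp Y - (X - Y)‖
        ≤ ((1 / 2 : NNReal) : ℝ) * ‖X - Y‖ :=
      happ X (hrs (by simpa using hX)) Y (hrs (by simpa using hY))
    have h2 : ‖X - Y‖ ≤ ‖NormedSpace.exp X - NormedSpace.exp Y‖ +
        ‖NormedSpace.exp X - NormedSpace.exp Y - (X - Y)‖ := by
      have e : X - Y = (NormedSpace.exp X - NormedSpace.exp Y) -
        (NormedSpace.exp X - NormedSpace.exp Y - (X - Y)) := by abel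
      conv_lhs => rw [e]
      exact norm_sub_le _ _
    norm_num at h3
    linarith
  · obtain ⟨X, hX, rfl⟩ := hδs (show M ∈ Metric.ball 1 δ by simpa [dist_eq_norm] using hM)
    exact ⟨X, by simpa using hX, rfl⟩

theorem exists_matrix_log (n : ℕ) : ∃ r > 0, ∃ δ > 0,
    (∀ X Y : Matrix (Fin n) (Fin n) ℂ, ‖X‖ < r → ‖Y‖ < r →
      ‖X - Y‖ ≤ 2 * ‖NormedSpace.exp X - NormedSpace.exp Y‖) ∧
    ∀ M : Matrix (Fin n) (Fin n) ℂ, ‖M - 1‖ < δ → ∃ X, ‖X‖ < r ∧ NormedSpace.exp X = M :=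
  exists_log _

theorem exp_mulVec_of_eigenvector {X : Matrix (Fin n) (Fin n) ℂ} {w : Fin n → ℂ} {z : ℂ}
    (hw : X *ᵥ w = z • w) : NormedSpace.exp X *ᵥ w = Complex.exp z • w := by
  have h1 : HasSum (fun k : ℕ => ((k.factorial⁻¹ : ℂ) • X ^ k) *ᵥ w) (NormedSpace.exp X *ᵥ w) :=
    (NormedSpace.exp_series_hasSum_exp' (𝕂 := ℂ) X).mapL ((mulVecL n).flip w)
  have h2 := (NormedSpace.exp_series_hasSum_exp' (𝕂 := ℂ) z).smul_const w
  have hpow : ∀ k : ℕ, X ^ k *ᵥ w = z ^ k • w := by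
    intro k
    induction k with
    | zero => simp
    | succ k ih =>
      rw [pow_succ, ← Matrix.mulVec_mulVec, hw, Matrix.mulVec_smul, ih, smul_smul, pow_succ,
        mul_comm]
  have h3 : ∀ k : ℕ, ((k.factorial⁻¹ : ℂ) • X ^ k) *ᵥ w
      = ((k.factorial⁻¹ : ℂ) • z ^ k) • w := by
    intro k
    rw [Matrix.smul_mulVec, hpow, smul_smul, smul_eq_mul]
  simp only [h3] at h1
  rw [Complex.exp_eq_exp_ℂ]
  exact h1.unique h2

theorem isRoot_charpoly_iff {X : Matrix (Fin n) (Fin n) ℂ} {z : ℂ} :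
    X.charpoly.eval z = 0 ↔ ∃ w : Fin n → ℂ, w ≠ 0 ∧ X *ᵥ w = z • w := by
  rw [Matrix.eval_charpoly, ← Matrix.exists_mulVec_eq_zero_iff]
  refine exists_congr fun w => and_congr_right fun _ => ?_
  rw [Matrix.sub_mulVec, sub_eq_zero, eq_comm]
  simp [Matrix.scalar_apply, ← Matrix.smul_one_eq_diagonal, Matrix.smul_mulVec]

/-- Every eigenvalue of `exp X` is the exponential of an eigenvalue of `X`: the eigenspace of
`exp X` is invariant under `X`. -/
theorem exists_eigenvalue_of_exp {X : Matrix (Fin n) (Fin n) ℂ} {v : Fin n → ℂ} {μ : ℂ}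
    (hv : v ≠ 0) (h : NormedSpace.exp X *ᵥ v = μ • v) :
    ∃ z : ℂ, Complex.exp z = μ ∧ ∃ w : Fin n → ℂ, w ≠ 0 ∧ X *ᵥ w = z • w := by
  set V := Module.End.eigenspace (Matrix.toLin' (NormedSpace.exp X)) μ with hV
  have hmem : ∀ u, u ∈ V ↔ NormedSpace.exp X *ᵥ u = μ • u := fun u => by
    rw [hV, Module.End.mem_eigenspace_iff, Matrix.toLin'_apply]
  have hinv : ∀ u ∈ V, Matrix.toLin' X u ∈ V := by
    intro u hu
    rw [hmem] at hu ⊢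
    rw [Matrix.toLin'_apply, Matrix.mulVec_mulVec,
      ← ((Commute.refl X).exp_right : Commute X (NormedSpace.exp X)).eq, ← Matrix.mulVec_mulVec,
      hu, Matrix.mulVec_smul]
  have : Nontrivial V := ⟨⟨⟨v, (hmem v).2 h⟩, 0, fun h0 => hv (congrArg Subtype.val h0)⟩⟩
  obtain ⟨z, hz⟩ := Module.End.exists_eigenvalue ((Matrix.toLin' X).restrict hinv)
  obtain ⟨⟨w, hwV⟩, hw⟩ := hz.exists_hasEigenvector
  have hw0 : w ≠ 0 := fun h0 => hw.2 (Subtype.ext h0)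
  have hwz : X *ᵥ w = z • w := congrArg Subtype.val hw.apply_eq_smul
  refine ⟨z, ?_, w, hw0, hwz⟩
  have h1 := exp_mulVec_of_eigenvector hwz
  rw [(hmem w).1 hwV] at h1
  exact (smul_left_injective ℂ hw0 h1).symm

/-- By Gelfand's formula, a matrix with all eigenvalues in the open unit disc has bounded powers. -/
theorem exists_norm_pow_le [NeZero n] {M : Matrix (Fin n) (Fin n) ℂ}
    (h : ∀ (μ : ℂ) (v : Fin n → ℂ), v ≠ 0 → M *ᵥ v = μ • v → ‖μ‖ < 1) :
    ∃ C, ∀ k : ℕ, ‖M ^ k‖ ≤ C := by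
  have hr : spectralRadius ℂ M < (1 : NNReal) := by
    apply spectrum.spectralRadius_lt_of_forall_lt
    intro μ hμ
    rw [spectrum.mem_iff, Matrix.isUnit_iff_isUnit_det, isUnit_iff_ne_zero, not_not,
      ← Matrix.exists_mulVec_eq_zero_iff] at hμ
    obtain ⟨v, hv, hMv⟩ := hμ
    rw [Matrix.sub_mulVec, sub_eq_zero, Algebra.algebraMap_eq_smul_one, Matrix.smul_mulVec,
      Matrix.one_mulVec] at hMv
    exact h μ v hv hMv.symm
  have hlim := spectrum.pow_nnnorm_pow_one_div_tendsto_nhds_spectralRadius M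
  obtain ⟨k₀, hk₀⟩ := eventually_atTop.1 (hlim.eventually (gt_mem_nhds hr))
  refine ⟨1 + ∑ k ∈ Finset.range (k₀ + 1), ‖M ^ k‖, fun k => ?_⟩
  by_cases hk : k < k₀ + 1
  · have := Finset.single_le_sum (f := fun k => ‖M ^ k‖) (fun i _ => norm_nonneg _)
      (Finset.mem_range.2 hk)
    linarith
  · have h1 := hk₀ k (by omega)
    have hkpos : (0 : ℝ) < 1 / k := by
      have : 0 < k := by omega
      positivity
    have h2 : ‖M ^ k‖ ≤ 1 := by
      by_contra! hlt
      have h3 : (1 : ENNReal) ≤ (‖M ^ k‖₊ : ENNReal) ^ (1 / k : ℝ) := by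
        apply ENNReal.one_le_rpow _ hkpos
        exact_mod_cast hlt.le
      exact absurd h1 (by simpa using h3)
    have : 0 ≤ ∑ k ∈ Finset.range (k₀ + 1), ‖M ^ k‖ := Finset.sum_nonneg fun _ _ => norm_nonneg _
    linarith

end MatrixExp

/-! ### The monodromy matrix -/

section Monodromy

open Asymptotics
open scoped Matrix.Norms.Operator Topology

variable {n : ℕ} (m : ℕ) (A₀ : Matrix (Fin n) (Fin n) ℂ) (B : ℤ → Matrix (Fin n) (Fin n) ℂ)

theorem exists_norm_coeffMatrix_le : ∃ K, 0 ≤ K ∧ ∀ ω ≥ 1, ∀ τ, ‖coeffMatrix m A₀ B (ω, τ)‖ ≤ K := by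
  refine ⟨_, ?_, fun ω hω τ => (norm_add_le _ _).trans (add_le_add (norm_trigEval_le τ _)
    ((norm_smul_le _ _).trans (mul_le_mul_of_nonneg_right (?_ : _ ≤ (1 : ℝ)) (norm_nonneg _))))⟩
  · exact add_nonneg (Finset.sum_nonneg fun _ _ => norm_nonneg _)
      (mul_nonneg zero_le_one (norm_nonneg _))
  · rw [Real.norm_of_nonneg (by positivity)]
    exact inv_le_one_of_one_le₀ hω

theorem continuous_coeffMatrix (ω : ℝ) : Continuous fun t => coeffMatrix m A₀ B (ω, ω * t) := by
  simp only [coeffMatrix, trigEval_eq_sum]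
  fun_prop

theorem periodic_coeffMatrix {ω : ℝ} (hω : ω ≠ 0) :
    Function.Periodic (fun t => coeffMatrix m A₀ B (ω, ω * t)) (2 * Real.pi / ω) := by
  intro t
  simp only [coeffMatrix]
  rw [mul_add, mul_div_cancel₀ _ hω, trigEval_add_two_pi]

theorem exists_norm_avgTrunc_le (N : ℕ) : ∃ a, 0 ≤ a ∧ ∀ ω ≥ 1, ‖avgTrunc m A₀ B N ω‖ ≤ a := by
  refine ⟨∑ k ∈ Finset.range N, ‖avgCoeff m A₀ B k‖, Finset.sum_nonneg fun _ _ => norm_nonneg _,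
    fun ω hω => (norm_sum_le _ _).trans (Finset.sum_le_sum fun k _ => ?_)⟩
  refine (norm_smul_le _ _).trans (mul_le_of_le_one_left (norm_nonneg _) ?_)
  rw [norm_pow]
  apply pow_le_one₀ (norm_nonneg _)
  rw [Real.norm_of_nonneg (by positivity)]
  exact inv_le_one_of_one_le₀ hω

/-- The derivative of `Ψ q exp (t W)` when `Ψ' = -Ψ a`: only the defect of the relation
`q' = a q - q W` remains. -/
theorem variation_identity {R : Type*} [Ring R] (ψ a q q' w e : R) :
    (-(ψ * a) * q + ψ * q') * e + ψ * q * (w * e) = ψ * (q' - (a * q - q * w)) * e := by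
  noncomm_ring

/-- Up to a bounded conjugation, the monodromy matrix is the exponential of the truncated averaged
system over one period, with an error `O(ω^{-N-1})`. -/
theorem exists_conj_monodromy (N : ℕ) {K : ℝ} (hK : 0 ≤ K) : ∃ C ω₀ : ℝ, 0 ≤ C ∧ 1 ≤ ω₀ ∧
    ∀ ω ≥ ω₀, ∀ Φ Ψ, IsFundamental (fun t => coeffMatrix m A₀ B (ω, ω * t)) K Φ Ψ →
    ∃ U : (Matrix (Fin n) (Fin n) ℂ)ˣ, ‖(U : Matrix (Fin n) (Fin n) ℂ)‖ ≤ C ∧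
      ‖((U⁻¹ : (Matrix (Fin n) (Fin n) ℂ)ˣ) : Matrix (Fin n) (Fin n) ℂ)‖ ≤ C ∧
      ‖((U⁻¹ : (Matrix (Fin n) (Fin n) ℂ)ˣ) : Matrix (Fin n) (Fin n) ℂ) * Φ (2 * Real.pi / ω) * U
        - NormedSpace.exp ((2 * Real.pi / ω) • avgTrunc m A₀ B N ω)‖ ≤ C * ω⁻¹ ^ (N + 1) := by
  obtain ⟨q, q', hq, hqper, hq1, hR⟩ := exists_averaging_transform m A₀ B N
  obtain ⟨c₁, hc₁, hq1⟩ := hq1.exists_pos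
  obtain ⟨c₂, hc₂, hR⟩ := hR.exists_pos
  obtain ⟨a, ha, haT⟩ := exists_norm_avgTrunc_le m A₀ B N
  rw [IsBigOWith_def] at hq1 hR
  have hfast : ∀ {P : ℝ × ℝ → Prop}, (∀ᶠ x in fastFilter, P x) →
      ∀ᶠ ω in (atTop : Filter ℝ), ∀ τ, P (ω, τ) := by
    intro P hP
    rw [fastFilter, ← principal_univ, eventually_prod_principal_iff] at hP
    filter_upwards [hP] with ω h τ using h τ (Set.mem_univ τ)
  have hexp : ∀ᶠ X in 𝓝 (0 : Matrix (Fin n) (Fin n) ℂ), ‖NormedSpace.exp X - 1‖ < 1 := by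
    have hc : ContinuousAt (fun X : Matrix (Fin n) (Fin n) ℂ => ‖NormedSpace.exp X - 1‖) 0 :=
      ((NormedSpace.exp_continuous.sub continuous_const).norm).continuousAt
    apply hc.eventually_lt continuousAt_const
    simp
  obtain ⟨η, hη, hexp⟩ := Metric.eventually_nhds_iff_ball.1 hexp
  have hlim : Tendsto (fun ω : ℝ => c₁ * ω⁻¹) atTop (𝓝 (c₁ * 0)) :=
    tendsto_inv_atTop_zero.const_mul _
  have hlim2 : Tendsto (fun ω : ℝ => 2 * Real.pi * a * ω⁻¹) atTop (𝓝 (2 * Real.pi * a * 0)) :=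
    tendsto_inv_atTop_zero.const_mul _
  rw [mul_zero] at hlim hlim2
  have hev := ((hfast hq1).and (hfast hR)).and ((hlim.eventually (gt_mem_nhds one_half_pos)).and
    (hlim2.eventually (gt_mem_nhds hη)))
  obtain ⟨ω₁, hω₁⟩ := eventually_atTop.1 hev
  set b := ‖(1 : Matrix (Fin n) (Fin n) ℂ)‖ with hb
  have hb0 : 0 ≤ b := norm_nonneg _
  set k := b * Real.exp (K * (2 * Real.pi)) with hk
  have hk0 : 0 ≤ k := by positivity
  set C' := 2 * b * (k * (k * c₂ * (1 + b) * (2 * Real.pi))) with hC'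
  have hC'0 : 0 ≤ C' := by positivity
  refine ⟨2 * b + 1 + C', max 1 ω₁, by positivity, le_max_left _ _, fun ω hω Φ Ψ hΦ => ?_⟩
  obtain ⟨⟨hq1, hR⟩, hlim, hlim2⟩ := hω₁ ω ((le_max_right _ _).trans hω)
  have hω1 : 1 ≤ ω := (le_max_left _ _).trans hω
  have hω0 : 0 < ω := by linarith
  set T := 2 * Real.pi / ω with hT
  have hTpos : 0 < T := by positivity
  have hT2 : T ≤ 2 * Real.pi := div_le_self (by positivity) hω1
  set W := avgTrunc m A₀ B N ω with hW
  have hq0 : ∀ τ, ‖q (ω, τ) - 1‖ ≤ 1 / 2 := fun τ => by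
    refine (hq1 τ).trans ?_
    simp only [Real.norm_of_nonneg (inv_pos.2 hω0).le]
    exact hlim.le
  have hunit : IsUnit (q (ω, 0)) := by
    have := (Units.oneSub (1 - q (ω, 0)) (by
      rw [norm_sub_rev]; exact (hq0 0).trans_lt (by norm_num))).isUnit
    simpa using this
  obtain ⟨U, hU⟩ := hunit
  have hUn : ‖(U : Matrix (Fin n) (Fin n) ℂ)‖ ≤ b + 1 / 2 := by
    have e : (U : Matrix (Fin n) (Fin n) ℂ) = 1 + (q (ω, 0) - 1) := by rw [hU]; abel
    rw [e]
    exact (norm_add_le _ _).trans (by linarith [hq0 0])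
  have hUi : ‖((U⁻¹ : (Matrix (Fin n) (Fin n) ℂ)ˣ) : Matrix (Fin n) (Fin n) ℂ)‖ ≤ 2 * b := by
    set V := ((U⁻¹ : (Matrix (Fin n) (Fin n) ℂ)ˣ) : Matrix (Fin n) (Fin n) ℂ)
    have hVU : V * U = 1 := U.inv_mul
    have e : V = 1 - V * (q (ω, 0) - 1) := by
      rw [← hU, mul_sub, hVU]; simp
    have h1 : ‖V‖ ≤ b + ‖V‖ * (1 / 2) := by
      conv_lhs => rw [e]
      refine (norm_sub_le _ _).trans (add_le_add le_rfl ((norm_mul_le _ _).trans ?_))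
      exact mul_le_mul_of_nonneg_left (hq0 0) (norm_nonneg _)
    linarith
  have hexpt : ∀ t ∈ Set.Icc 0 T, ‖NormedSpace.exp (t • W)‖ ≤ 1 + b := by
    intro t ht
    have h1 : ‖t • W‖ < η := by
      rw [norm_smul, Real.norm_of_nonneg ht.1]
      calc t * ‖W‖ ≤ T * a := mul_le_mul ht.2 (haT ω hω1) (norm_nonneg _) hTpos.le
        _ = 2 * Real.pi * a * ω⁻¹ := by rw [hT]; ring
        _ < η := hlim2
    have h2 := hexp (t • W) (by simpa using h1)
    have e : NormedSpace.exp (t • W) = (NormedSpace.exp (t • W) - 1) + 1 := by abel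
    rw [e]
    exact (norm_add_le _ _).trans (by linarith)
  have hkt : ∀ t ∈ Set.Icc 0 T, b * Real.exp (K * |t|) ≤ k := by
    intro t ht
    rw [hk, abs_of_nonneg ht.1]
    gcongr
    exact ht.2.trans hT2
  set R : ℝ → Matrix (Fin n) (Fin n) ℂ := fun t => q' (ω, ω * t)
    - (coeffMatrix m A₀ B (ω, ω * t) * q (ω, ω * t) - q (ω, ω * t) * W) with hRdef
  -- variation of constants: the approximate solution `q exp (t W)` is pulled back by `Ψ`
  set H : ℝ → Matrix (Fin n) (Fin n) ℂ := fun t => Ψ t * q (ω, ω * t) * NormedSpace.exp (t • W)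
    with hH
  have hHd : ∀ t ∈ Set.Icc 0 T, HasDerivWithinAt H (Ψ t * R t * NormedSpace.exp (t • W))
      (Set.Icc 0 T) t := by
    intro t _
    refine ((((hΦ.hasDerivAt_right t).mul (hq ω hω0.ne' t)).mul
      (hasDerivAt_exp_smul_const' (𝕂 := ℝ) W t)).congr_deriv ?_).hasDerivWithinAt
    exact variation_identity _ _ _ _ _ _
  have hHb : ∀ t ∈ Set.Icc 0 T, ‖Ψ t * R t * NormedSpace.exp (t • W)‖
      ≤ k * (c₂ * ω⁻¹ ^ N) * (1 + b) := by
    intro t ht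
    refine (norm_mul_le _ _).trans (mul_le_mul ((norm_mul_le _ _).trans (mul_le_mul
      ((hΦ.norm_right_le t).trans (hkt t ht)) ?_ (norm_nonneg _) hk0)) (hexpt t ht)
      (norm_nonneg _) (by positivity))
    refine (hR (ω * t)).trans ?_
    rw [Real.norm_of_nonneg (by positivity)]
  have hHT := (convex_Icc 0 T).norm_image_sub_le_of_norm_hasDerivWithin_le hHd hHb
    (Set.left_mem_Icc.2 hTpos.le) (Set.right_mem_Icc.2 hTpos.le)
  have hqT : q (ω, ω * T) = U := by
    rw [hU, hT, mul_div_cancel₀ _ hω0.ne', ← zero_add (2 * Real.pi), hqper]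
  have e0 : H 0 = U := by simp [hH, hΦ.right_zero, hU]
  have eT : H T = Ψ T * U * NormedSpace.exp (T • W) := by simp only [hH, hqT]
  rw [e0, eT, sub_zero, Real.norm_of_nonneg hTpos.le] at hHT
  refine ⟨U, by linarith, by linarith, ?_⟩
  have e : ((U⁻¹ : (Matrix (Fin n) (Fin n) ℂ)ˣ) : Matrix (Fin n) (Fin n) ℂ) * Φ T * U
        - NormedSpace.exp (T • W)
      = -(((U⁻¹ : (Matrix (Fin n) (Fin n) ℂ)ˣ) : Matrix (Fin n) (Fin n) ℂ) *
        (Φ T * (Ψ T * U * NormedSpace.exp (T • W) - U))) := by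
    rw [mul_sub, ← mul_assoc (Φ T), ← mul_assoc (Φ T), hΦ.left_mul_right, one_mul, mul_sub,
      ← mul_assoc _ (U : Matrix (Fin n) (Fin n) ℂ), Units.inv_mul, one_mul, neg_sub, mul_assoc]
  rw [e, norm_neg]
  have hTin : T ∈ Set.Icc 0 T := Set.right_mem_Icc.2 hTpos.le
  calc _ ≤ 2 * b * (k * (k * (c₂ * ω⁻¹ ^ N) * (1 + b) * T)) :=
        (norm_mul_le _ _).trans (mul_le_mul hUi ((norm_mul_le _ _).trans (mul_le_mul
          ((hΦ.norm_left_le T).trans (hkt T hTin)) hHT (norm_nonneg _) hk0)) (norm_nonneg _)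
          (by positivity))
    _ = C' * ω⁻¹ ^ (N + 1) := by rw [hC', hT]; ring
    _ ≤ _ := by gcongr; linarith

end Monodromy

/-! ### Hurwitz determinants of the averaged system -/

theorem hurwitzDet_map {R S : Type*} [CommRing R] [CommRing S] {n : ℕ} (φ : R →+* S)
    (M : Matrix (Fin n) (Fin n) R) (j : Fin n) :
    hurwitzDet (M.map φ) j = φ (hurwitzDet M j) := by
  rw [hurwitzDet, hurwitzDet, RingHom.map_det]
  congr 1
  ext a b
  simp only [hurwitzMatrix, charCoeff, Matrix.submatrix_apply, Matrix.of_apply,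
    RingHom.mapMatrix_apply, Matrix.map_apply]
  rw [Matrix.charpoly_map]
  split_ifs with h
  · rw [Polynomial.coeff_map]
  · rw [map_zero]

theorem hurwitzDet_congr {R : Type*} [CommRing R] {n : ℕ} {M M' : Matrix (Fin n) (Fin n) R}
    (h : M.charpoly = M'.charpoly) (j : Fin n) : hurwitzDet M j = hurwitzDet M' j := by
  rw [hurwitzDet_eq_hurwitzMinor, hurwitzDet_eq_hurwitzMinor, h]

theorem charpoly_smul_units_conj {n : ℕ} (U : (Matrix (Fin n) (Fin n) ℂ)ˣ)
    (X : Matrix (Fin n) (Fin n) ℂ) (c : ℝ) :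
    (c • (U.val * X * U⁻¹.val)).charpoly = (c • X).charpoly := by
  rw [← Matrix.charpoly_units_conj U (c • X), mul_smul_comm, smul_mul_assoc, Matrix.coe_units_inv]

section Hurwitz

open Asymptotics PowerSeries
open scoped Matrix.Norms.Operator Topology

variable {n : ℕ}

theorem isBigO_inv_atTop : (fun ω : ℝ => ω⁻¹) =O[atTop] fun _ => (1 : ℝ) :=
  tendsto_inv_atTop_zero.isBigO_one ℝ

theorem isBigO_symbol (r : ℂ) :
    (fun _ : ℝ => RingHom.id ℂ r) =O[atTop] fun _ => (1 : ℝ) :=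
  isBigO_const_const _ one_ne_zero _

/-- Expansions in powers of `ω⁻¹` as `ω → ∞` of scalar functions. -/
abbrev HasScalarExpansion (N : ℕ) (f : ℝ → ℂ) (F : ℂ⟦X⟧) : Prop :=
  HasExpansion atTop (fun ω : ℝ => ω⁻¹) (fun _ => RingHom.id ℂ) N f F

/-- Matrices with entries that are functions paired with their expansions form a matrix ring over
`expansionSubring`, and Hurwitz determinants commute with both projections. -/
theorem HasScalarExpansion.hurwitzDet {N : ℕ} {L : ℝ → Matrix (Fin n) (Fin n) ℂ}
    {F : Matrix (Fin n) (Fin n) ℂ⟦X⟧}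
    (h : ∀ i j, HasScalarExpansion N (fun ω => L ω i j) (F i j)) (j : Fin n) :
    HasScalarExpansion N (fun ω => hurwitzDet (L ω) j) (hurwitzDet F j) := by
  set 𝒮 := expansionSubring isBigO_inv_atTop isBigO_symbol N
  let M : Matrix (Fin n) (Fin n) 𝒮 := Matrix.of fun i j => ⟨(fun ω => L ω i j, F i j), h i j⟩
  have h1 : ∀ ω, HighFreq.hurwitzDet (L ω) j
      = (HighFreq.hurwitzDet M j).1.1 ω := fun ω =>
    hurwitzDet_map (((Pi.evalRingHom (fun _ : ℝ => ℂ) ω).comp (RingHom.fst (ℝ → ℂ) ℂ⟦X⟧)).comp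
      𝒮.subtype) M j
  have h2 : HighFreq.hurwitzDet F j = (HighFreq.hurwitzDet M j).1.2 :=
    hurwitzDet_map ((RingHom.snd (ℝ → ℂ) ℂ⟦X⟧).comp 𝒮.subtype) M j
  have h3 : HasScalarExpansion N (HighFreq.hurwitzDet M j).1.1
    (HighFreq.hurwitzDet M j).1.2 := (HighFreq.hurwitzDet M j).2
  rw [h2, funext h1]
  exact h3

/-- The leading term of an expansion. -/
theorem HasScalarExpansion.tendsto {N : ℕ} {f : ℝ → ℂ} {F : ℂ⟦X⟧} (h : HasScalarExpansion N f F)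
    (hN : F.order.toNat < N) :
    Tendsto (fun ω : ℝ => ω ^ F.order.toNat • f ω) atTop (𝓝 (firstCoeff F)) := by
  set q := F.order.toNat
  have h1 := h.mono isBigO_inv_atTop isBigO_symbol (Nat.succ_le_of_lt hN)
  rw [HasExpansion] at h1
  have h2 : ∀ ω : ℝ, ∑ k ∈ Finset.range (q + 1), ω⁻¹ ^ k • RingHom.id ℂ (coeff k F)
      = ω⁻¹ ^ q • firstCoeff F := by
    intro ω
    rw [Finset.sum_range_succ, Finset.sum_eq_zero, zero_add]
    · rfl
    · intro k hk
      rw [coeff_of_lt_order_toNat k (Finset.mem_range.1 hk)]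
      simp
  simp only [h2] at h1
  have h3 := ((isBigO_refl (fun ω : ℝ => ω ^ q) atTop).smul h1)
  have h4 : (fun ω : ℝ => ω ^ q • (f ω - ω⁻¹ ^ q • firstCoeff F)) =O[atTop] fun ω => ω⁻¹ := by
    refine h3.congr' EventuallyEq.rfl ?_
    filter_upwards [eventually_gt_atTop 0] with ω hω
    rw [smul_eq_mul, pow_succ, ← mul_assoc, ← mul_pow, mul_inv_cancel₀ hω.ne', one_pow, one_mul]
  have h5 := h4.trans_tendsto tendsto_inv_atTop_zero
  have h6 := h5.add_const (firstCoeff F)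
  rw [zero_add] at h6
  refine h6.congr' ?_
  filter_upwards [eventually_gt_atTop 0] with ω hω
  rw [smul_sub, smul_smul, ← mul_pow, mul_inv_cancel₀ hω.ne', one_pow, one_smul, sub_add_cancel]

theorem HasScalarExpansion.eventually_ne_zero {N : ℕ} {f : ℝ → ℂ} {F : ℂ⟦X⟧}
    (h : HasScalarExpansion N f F) (hN : F.order.toNat < N) (hF : F ≠ 0) :
    ∀ᶠ ω in atTop, f ω ≠ 0 := by
  filter_upwards [(h.tendsto hN).eventually_ne (coeff_order hF)] with ω hω h0
  exact hω (by rw [h0, smul_zero])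

theorem HasScalarExpansion.eventually_re_pos {N : ℕ} {f : ℝ → ℂ} {F : ℂ⟦X⟧}
    (h : HasScalarExpansion N f F) (hN : F.order.toNat < N) (hF : 0 < firstCoeff F) :
    ∀ᶠ ω in atTop, 0 < (f ω).re := by
  have h1 := (Complex.continuous_re.tendsto _).comp (h.tendsto hN)
  filter_upwards [h1.eventually (lt_mem_nhds (Complex.lt_def.1 hF).1), eventually_gt_atTop 0]
    with ω hω hpos
  simp only [Function.comp, Complex.zero_re, Complex.smul_re, smul_eq_mul] at hω
  exact pos_of_mul_pos_right hω (by positivity)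

theorem HasScalarExpansion.eventually_re_neg {N : ℕ} {f : ℝ → ℂ} {F : ℂ⟦X⟧}
    (h : HasScalarExpansion N f F) (hN : F.order.toNat < N) (hF : firstCoeff F < 0) :
    ∀ᶠ ω in atTop, (f ω).re < 0 := by
  have h1 := (Complex.continuous_re.tendsto _).comp (h.tendsto hN)
  filter_upwards [h1.eventually (gt_mem_nhds (Complex.lt_def.1 hF).1), eventually_gt_atTop 0]
    with ω hω hpos
  simp only [Function.comp, Complex.zero_re, Complex.smul_re, smul_eq_mul] at hω
  exact neg_of_mul_neg_right hω (by positivity)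

theorem norm_entry_le (M : Matrix (Fin n) (Fin n) ℂ) (i j : Fin n) : ‖M i j‖ ≤ ‖M‖ := by
  have h1 : M i j = (M *ᵥ Pi.single j 1) i := by simp
  have h2 : ‖(Pi.single j 1 : Fin n → ℂ)‖ ≤ 1 := by
    rw [pi_norm_le_iff_of_nonneg zero_le_one]
    intro k
    by_cases hk : k = j
    · subst hk; simp
    · simp [hk]
  rw [h1]
  refine (norm_le_pi_norm _ i).trans ((Matrix.linfty_opNorm_mulVec _ _).trans ?_)
  exact mul_le_of_le_one_right (norm_nonneg _) h2

variable (m : ℕ) (A₀ : Matrix (Fin n) (Fin n) ℂ) (B : ℤ → Matrix (Fin n) (Fin n) ℂ)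

theorem hasScalarExpansion_entry {N : ℕ} {L : ℝ → Matrix (Fin n) (Fin n) ℂ} {C ω₀ : ℝ}
    (hL : ∀ ω ≥ ω₀, ‖L ω - avgTrunc m A₀ B N ω‖ ≤ C * ω⁻¹ ^ N) (i j : Fin n) :
    HasScalarExpansion N (fun ω => L ω i j) (avgMatrix m A₀ B i j) := by
  apply IsBigO.of_bound C
  filter_upwards [eventually_ge_atTop ω₀, eventually_gt_atTop 0] with ω hω hpos
  rw [Real.norm_of_nonneg (by positivity)]
  refine le_trans (le_of_eq ?_) ((norm_entry_le _ i j).trans (hL ω hω))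
  congr 1
  simp [avgTrunc, avgMatrix, Matrix.sum_apply]

end Hurwitz

/-! ### Reality of the monodromy matrix and of its logarithm -/

section Reality

open scoped Matrix.Norms.Operator Topology

variable {n : ℕ}

/-- Entrywise complex conjugation of matrices, as a continuous real-linear map. -/
def conjL (n : ℕ) : Matrix (Fin n) (Fin n) ℂ →L[ℝ] Matrix (Fin n) (Fin n) ℂ :=
  LinearMap.mkContinuous
    { toFun := fun M => M.map (starRingEnd ℂ)
      map_add' := fun M N => by ext; simp
      map_smul' := fun c M => by ext; simp } 1 fun M => by
    rw [one_mul]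
    apply le_of_eq
    change ‖M.map (starRingEnd ℂ)‖ = _
    simp [Matrix.linfty_opNorm_def]

theorem norm_map_conj (M : Matrix (Fin n) (Fin n) ℂ) : ‖M.map (starRingEnd ℂ)‖ = ‖M‖ := by
  simp [Matrix.linfty_opNorm_def]

theorem exp_map_conj (M : Matrix (Fin n) (Fin n) ℂ) :
    NormedSpace.exp (M.map (starRingEnd ℂ)) = (NormedSpace.exp M).map (starRingEnd ℂ) :=
  (NormedSpace.map_exp (starRingEnd ℂ).mapMatrix (conjL n).continuous M).symm

/-- The fundamental matrix of a real system is real. -/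
theorem IsFundamental.map_conj {A Φ Ψ : ℝ → Matrix (Fin n) (Fin n) ℂ} {K : ℝ}
    (h : IsFundamental A K Φ Ψ) (hA : ∀ t, (A t).map (starRingEnd ℂ) = A t) (t : ℝ) :
    (Φ t).map (starRingEnd ℂ) = Φ t := by
  have := h.eq_mul_of_hasDerivAt (X := fun t => (Φ t).map (starRingEnd ℂ)) (fun t => by
    have h1 : HasDerivAt (fun t => (Φ t).map (starRingEnd ℂ))
        ((A t * Φ t).map (starRingEnd ℂ)) t :=
      (conjL n).hasFDerivAt.comp_hasDerivAt t (h.hasDerivAt_left t)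
    rwa [Matrix.map_mul, hA] at h1) t
  rw [this, h.left_zero]
  simp [Matrix.map_one]

variable (m : ℕ) (A₀ : Matrix (Fin n) (Fin n) ℂ) (B : ℤ → Matrix (Fin n) (Fin n) ℂ)

theorem coeffMatrix_eq (ω τ : ℝ) : coeffMatrix m A₀ B (ω, τ)
    = A₀ + ∑ l ∈ harmonics m, Complex.exp (Complex.I * l * τ) • B l + ω⁻¹ • B 0 := by
  simp only [coeffMatrix, map_add, trigEval_C, map_sum, trigEval_C_mul_T]

theorem coeffMatrix_map_conj (hA₀ : ∀ i j, (A₀ i j).im = 0) (hB₀ : ∀ i j, (B 0 i j).im = 0)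
    (hB : ∀ l : ℤ, 1 ≤ l → l ≤ m → B (-l) = (B l).map (starRingEnd ℂ)) (ω τ : ℝ) :
    (coeffMatrix m A₀ B (ω, τ)).map (starRingEnd ℂ) = coeffMatrix m A₀ B (ω, τ) := by
  have hreal : ∀ M : Matrix (Fin n) (Fin n) ℂ, (∀ i j, (M i j).im = 0) → conjL n M = M := by
    intro M hM
    ext i j
    exact Complex.conj_eq_iff_im.2 (hM i j)
  have hsmul : ∀ (c : ℂ) (M : Matrix (Fin n) (Fin n) ℂ),
      conjL n (c • M) = (starRingEnd ℂ) c • M.map (starRingEnd ℂ) := by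
    intro c M
    ext i j
    exact map_mul (starRingEnd ℂ) c (M i j)
  change conjL n (coeffMatrix m A₀ B (ω, τ)) = _
  rw [coeffMatrix_eq, map_add, map_add, map_smul, hreal _ hA₀, hreal _ hB₀, map_sum]
  congr 2
  refine Finset.sum_equiv (Equiv.neg ℤ) (fun l => ?_) (fun l hl => ?_)
  · simp only [harmonics, Finset.mem_erase, Finset.mem_Icc, Equiv.neg_apply]
    omega
  · simp only [harmonics, Finset.mem_erase, Finset.mem_Icc] at hl
    have hBl : (B l).map (starRingEnd ℂ) = B (-l) := by
      rcases lt_or_gt_of_ne hl.1 with h | h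
      · have := hB (-l) (by omega) (by omega)
        rw [neg_neg] at this
        rw [this]
        ext i j; simp
      · exact (hB l (by omega) (by omega)).symm
    rw [hsmul, hBl, ← Complex.exp_conj]
    simp

/-- For large `ω` the monodromy matrix is `exp (T L)` with `T = 2π/ω` and a real matrix `L` which is
similar to the truncated averaged matrix up to an error `O(ω^{-N})`. -/
theorem exists_real_log (N : ℕ) {K : ℝ} (hK : 0 ≤ K) (hA₀ : ∀ i j, (A₀ i j).im = 0)
    (hB₀ : ∀ i j, (B 0 i j).im = 0)
    (hB : ∀ l : ℤ, 1 ≤ l → l ≤ m → B (-l) = (B l).map (starRingEnd ℂ)) :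
    ∃ C ω₀ : ℝ, 1 ≤ ω₀ ∧
    ∀ ω ≥ ω₀, ∀ Φ Ψ, IsFundamental (fun t => coeffMatrix m A₀ B (ω, ω * t)) K Φ Ψ →
    ∃ L L₁ : Matrix (Fin n) (Fin n) ℂ,
      NormedSpace.exp ((2 * Real.pi / ω) • L) = Φ (2 * Real.pi / ω) ∧
      L.map (starRingEnd ℂ) = L ∧ ‖(2 * Real.pi / ω) • L‖ < 1 ∧ L.charpoly = L₁.charpoly ∧
      ‖L₁ - avgTrunc m A₀ B N ω‖ ≤ C * ω⁻¹ ^ N := by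
  obtain ⟨C, ω₁, hC, hω₁, hconj⟩ := exists_conj_monodromy m A₀ B N hK
  obtain ⟨a, ha, haT⟩ := exists_norm_avgTrunc_le m A₀ B N
  obtain ⟨r, hr, δ, hδ, hlip, hlog⟩ := exists_matrix_log n
  have hexp : ∀ᶠ X in 𝓝 (0 : Matrix (Fin n) (Fin n) ℂ), ‖NormedSpace.exp X - 1‖ < δ / 2 := by
    have hc : ContinuousAt (fun X : Matrix (Fin n) (Fin n) ℂ => ‖NormedSpace.exp X - 1‖) 0 :=
      ((NormedSpace.exp_continuous.sub continuous_const).norm).continuousAt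
    apply hc.eventually_lt continuousAt_const
    simpa using hδ
  obtain ⟨η, hη, hexp⟩ := Metric.eventually_nhds_iff_ball.1 hexp
  have hlim : ∀ c : ℝ, ∀ b > 0, ∀ᶠ ω : ℝ in atTop, c * ω⁻¹ < b := by
    intro c b hb
    have := (tendsto_inv_atTop_zero (𝕜 := ℝ)).const_mul c
    rw [mul_zero] at this
    exact this.eventually (gt_mem_nhds hb)
  obtain ⟨ω₂, hω₂⟩ := eventually_atTop.1 (((hlim (2 * Real.pi * a) η hη).and
    (hlim (2 * Real.pi * a) r hr)).and (((hlim C (δ / 2) (by positivity))).and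
    (hlim (C * (2 * Real.pi * a + 2 * C) * C) (min r 1) (by positivity))))
  refine ⟨C, max ω₁ ω₂, hω₁.trans (le_max_left _ _), fun ω hω Φ Ψ hΦ => ?_⟩
  obtain ⟨⟨h1, h2⟩, h3, h4⟩ := hω₂ ω ((le_max_right _ _).trans hω)
  have hω1 : 1 ≤ ω := hω₁.trans ((le_max_left _ _).trans hω)
  have hω0 : 0 < ω := by linarith
  obtain ⟨U, hU, hUi, hG⟩ := hconj ω ((le_max_left _ _).trans hω) Φ Ψ hΦ
  set V := ((U⁻¹ : (Matrix (Fin n) (Fin n) ℂ)ˣ) : Matrix (Fin n) (Fin n) ℂ) with hV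
  set T := 2 * Real.pi / ω with hT
  have hTpos : 0 < T := by positivity
  set Y := T • avgTrunc m A₀ B N ω with hY
  have hYn : ‖Y‖ ≤ 2 * Real.pi * a * ω⁻¹ := by
    rw [hY, norm_smul, Real.norm_of_nonneg hTpos.le]
    calc T * ‖avgTrunc m A₀ B N ω‖ ≤ T * a := by gcongr; exact haT ω hω1
      _ = 2 * Real.pi * a * ω⁻¹ := by rw [hT]; ring
  have hpow : ω⁻¹ ^ (N + 1) ≤ ω⁻¹ := by
    rw [pow_succ]
    apply mul_le_of_le_one_left (by positivity)
    exact pow_le_one₀ (by positivity) (inv_le_one_of_one_le₀ hω1)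
  have hG1 : ‖V * Φ T * U - 1‖ < δ := by
    have e : V * Φ T * U - 1 = (V * Φ T * U - NormedSpace.exp Y) + (NormedSpace.exp Y - 1) := by
      abel
    rw [e]
    refine (norm_add_le _ _).trans_lt ?_
    have := hexp Y (by simpa using hYn.trans_lt h1)
    have : C * ω⁻¹ ^ (N + 1) ≤ C * ω⁻¹ := by gcongr
    linarith
  obtain ⟨X₁, hX₁r, hX₁⟩ := hlog _ hG1
  have hXY := hlip X₁ Y hX₁r (hYn.trans_lt h2)
  rw [hX₁] at hXY
  have hXY' : ‖X₁ - Y‖ ≤ 2 * C * ω⁻¹ ^ (N + 1) := by linarith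
  have hX₁n : ‖X₁‖ ≤ (2 * Real.pi * a + 2 * C) * ω⁻¹ := by
    have e : X₁ = Y + (X₁ - Y) := by abel
    rw [e]
    refine (norm_add_le _ _).trans ?_
    have : 2 * C * ω⁻¹ ^ (N + 1) ≤ 2 * C * ω⁻¹ := by gcongr
    linarith
  set X := (U : Matrix (Fin n) (Fin n) ℂ) * X₁ * V with hX
  have hXexp : NormedSpace.exp X = Φ T := by
    have h5 : NormedSpace.exp X = (U : Matrix (Fin n) (Fin n) ℂ) * NormedSpace.exp X₁ * V :=
      NormedSpace.exp_units_conj U X₁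
    rw [h5, hX₁]
    have e1 : (U : Matrix (Fin n) (Fin n) ℂ) * V = 1 := U.mul_inv
    calc (U : Matrix (Fin n) (Fin n) ℂ) * (V * Φ T * U) * V
        = (U * V) * Φ T * (U * V) := by simp only [mul_assoc]
      _ = Φ T := by rw [e1, one_mul, mul_one]
  have hXn : ‖X‖ < min r 1 := by
    refine lt_of_le_of_lt ?_ h4
    calc ‖X‖ ≤ ‖(U : Matrix (Fin n) (Fin n) ℂ)‖ * ‖X₁‖ * ‖V‖ :=
          (norm_mul_le _ _).trans (mul_le_mul_of_nonneg_right (norm_mul_le _ _) (norm_nonneg _))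
      _ ≤ C * ((2 * Real.pi * a + 2 * C) * ω⁻¹) * C := by gcongr
      _ = C * (2 * Real.pi * a + 2 * C) * C * ω⁻¹ := by ring
  -- the conjugate of `X` is a small logarithm of the same matrix
  have hXreal : X.map (starRingEnd ℂ) = X := by
    have h6 : NormedSpace.exp (X.map (starRingEnd ℂ)) = NormedSpace.exp X := by
      rw [exp_map_conj, hXexp]
      exact hΦ.map_conj (fun t => coeffMatrix_map_conj m A₀ B hA₀ hB₀ hB _ _) T
    have hXr : ‖X‖ < r := hXn.trans_le (min_le_left _ _)
    have := hlip (X.map (starRingEnd ℂ)) X (by rwa [norm_map_conj]) hXr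
    rw [h6, sub_self, norm_zero, mul_zero] at this
    exact sub_eq_zero.1 (norm_le_zero_iff.1 this)
  have hTX : T • (T⁻¹ • X) = X := by rw [smul_smul, mul_inv_cancel₀ hTpos.ne', one_smul]
  refine ⟨T⁻¹ • X, T⁻¹ • X₁, by rw [hTX, hXexp], ?_, ?_, ?_, ?_⟩
  · change conjL n (T⁻¹ • X) = _
    rw [map_smul]
    exact congrArg (T⁻¹ • ·) hXreal
  · rw [hTX]; exact hXn.trans_le (min_le_right _ _)
  · exact charpoly_smul_units_conj U X₁ T⁻¹
  · have e : T⁻¹ • X₁ - avgTrunc m A₀ B N ω = T⁻¹ • (X₁ - Y) := by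
      rw [hY, smul_sub, smul_smul, inv_mul_cancel₀ hTpos.ne', one_smul]
    rw [e, norm_smul, Real.norm_of_nonneg (by positivity)]
    calc T⁻¹ * ‖X₁ - Y‖ ≤ T⁻¹ * (2 * C * ω⁻¹ ^ (N + 1)) := by gcongr
      _ = (C * ω⁻¹ ^ N) * Real.pi⁻¹ := by rw [hT, pow_succ]; field_simp
      _ ≤ C * ω⁻¹ ^ N := by
        apply mul_le_of_le_one_right (by positivity)
        exact inv_le_one_of_one_le₀ (by linarith [Real.pi_gt_three])

end Reality

/-! ### Periodic solutions and their stability -/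

section Final

open scoped Matrix.Norms.Operator Topology

variable {n : ℕ}

/-- The Routh–Hurwitz criterion for a real matrix `L` with nonzero Hurwitz determinants, stated
for eigenvalues. -/
theorem routhHurwitz_matrix [NeZero n] {L : Matrix (Fin n) (Fin n) ℂ}
    (hL : L.map (starRingEnd ℂ) = L) (hD : ∀ j, hurwitzDet L j ≠ 0) :
    ((∀ j, 0 < (hurwitzDet L j).re) →
      ∀ (z : ℂ) (w : Fin n → ℂ), w ≠ 0 → L *ᵥ w = z • w → z.re < 0) ∧
    ((∃ j, (hurwitzDet L j).re < 0) →
      ∃ (z : ℂ) (w : Fin n → ℂ), w ≠ 0 ∧ L *ᵥ w = z • w ∧ 0 < z.re) ∧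
    ∀ w : Fin n → ℂ, L *ᵥ w = 0 → w = 0 := by
  set L' : Matrix (Fin n) (Fin n) ℝ := L.map Complex.re with hL'
  have hLL : L = L'.map Complex.ofRealHom := by
    ext i j
    have := congrFun (congrFun hL i) j
    exact (Complex.conj_eq_iff_re.1 this).symm
  set p := L'.charpoly with hp
  have hpd : p.natDegree = n := by rw [hp, Matrix.charpoly_natDegree_eq_dim, Fintype.card_fin]
  have hpc : p.coeff n = 1 := by
    have := (Matrix.charpoly_monic L').coeff_natDegree
    rwa [← hp, hpd] at this
  have hdet : ∀ j : Fin n, hurwitzDet L j = (hurwitzMinor (descCoeff n p) (j + 1) : ℝ) := by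
    intro j
    conv_lhs => rw [hLL]
    rw [hurwitzDet_map, hurwitzDet_eq_hurwitzMinor]; rfl
  have hroot : ∀ z : ℂ, Polynomial.aeval z p = 0 ↔
      ∃ w : Fin n → ℂ, w ≠ 0 ∧ L *ᵥ w = z • w := by
    intro z
    rw [← isRoot_charpoly_iff, hLL, Matrix.charpoly_map, Polynomial.eval_map]
    rfl
  have hne : ∀ j < n, hurwitzMinor (descCoeff n p) (j + 1) ≠ 0 := by
    intro j hj h
    apply hD ⟨j, hj⟩
    rw [hdet]; simp [h]
  refine ⟨fun h z w hw hz => ?_, fun ⟨j, hj⟩ => ?_, fun w hw => ?_⟩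
  · apply re_neg_of_hurwitzMinor_pos n p hpd (by rw [hpc]; exact one_pos) _ z
      ((hroot z).2 ⟨w, hw, hz⟩)
    intro j hj
    have := h ⟨j, hj⟩
    rwa [hdet, Complex.ofReal_re] at this
  · by_contra! hcon
    have := hurwitzMinor_pos_of_re_nonpos n p hpd (by rw [hpc]; exact one_pos) hne
      (fun z hz => by
        obtain ⟨w, hw, hwz⟩ := (hroot z).1 hz
        exact hcon z w hw hwz) j j.isLt
    rw [hdet, Complex.ofReal_re] at hj
    exact absurd hj (not_lt.2 this.le)
  · by_contra hw0
    have h0 : Polynomial.aeval (0 : ℂ) p = 0 := (hroot 0).2 ⟨w, hw0, by rw [hw, zero_smul]⟩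
    have h1 : p.coeff 0 = 0 := by
      rw [← Polynomial.coeff_zero_eq_aeval_zero'] at h0
      simpa using h0
    have hn : 0 < n := Nat.pos_of_ne_zero (NeZero.ne n)
    apply hne (n - 1) (by omega)
    rw [Nat.sub_add_cancel hn]
    exact hurwitzMinor_eq_zero_of_coeff_zero hn p h1

variable (m : ℕ) (A₀ : Matrix (Fin n) (Fin n) ℂ) (B : ℤ → Matrix (Fin n) (Fin n) ℂ)
  (d : ℤ → Fin n → ℂ)

/-- The free term of the system. -/
def forcing (ω t : ℝ) : Fin n → ℂ :=
  ∑ l ∈ harmonics m, Complex.exp (Complex.I * l * ((ω * t : ℝ) : ℂ)) • d l + d 0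

theorem rhs_eq (ω : ℝ) : rhs m A₀ B d ω
    = fun t x => coeffMatrix m A₀ B (ω, ω * t) *ᵥ x + forcing m d ω t := by
  funext t x
  have e : ∀ l : ℤ, Complex.I * l * ω * t = Complex.I * l * ((ω * t : ℝ) : ℂ) := by
    intro l; push_cast; ring
  simp only [rhs, e, forcing, coeffMatrix_eq, Matrix.add_mulVec, Matrix.sum_mulVec,
    Matrix.smul_mulVec, smul_add, Finset.sum_add_distrib]
  rw [← Complex.ofReal_inv, Complex.coe_smul]
  abel

theorem continuous_forcing (ω : ℝ) : Continuous (forcing m d ω) := by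
  unfold forcing
  fun_prop

theorem periodic_forcing {ω : ℝ} (hω : ω ≠ 0) :
    Function.Periodic (forcing m d ω) (2 * Real.pi / ω) := by
  intro t
  simp only [forcing]
  rw [mul_add, mul_div_cancel₀ _ hω]
  congr 1
  refine Finset.sum_congr rfl fun l _ => ?_
  congr 1
  rw [Complex.exp_eq_exp_iff_exists_int]
  exact ⟨l, by push_cast; ring⟩

/-- The conclusion for a fixed frequency, once the monodromy matrix is written as `exp (T L)` with
`T L` small and `L` satisfying the hypotheses of the Routh–Hurwitz criterion. -/
theorem stability_of_log [NeZero n] {ω : ℝ} (hω : 0 < ω) {K : ℝ} (hK : 0 ≤ K)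
    {Φ Ψ : ℝ → Matrix (Fin n) (Fin n) ℂ}
    (hΦ : IsFundamental (fun t => coeffMatrix m A₀ B (ω, ω * t)) K Φ Ψ)
    {L : Matrix (Fin n) (Fin n) ℂ}
    (hexp : NormedSpace.exp ((2 * Real.pi / ω) • L) = Φ (2 * Real.pi / ω))
    (hL : L.map (starRingEnd ℂ) = L) (hsmall : ‖(2 * Real.pi / ω) • L‖ < 1)
    (hD : ∀ j, hurwitzDet L j ≠ 0) :
    ∃ x : ℝ → Fin n → ℂ, IsPeriodicSolution m A₀ B d ω x ∧
      (∀ z, IsPeriodicSolution m A₀ B d ω z → z = x) ∧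
      ((∀ j, 0 < (hurwitzDet L j).re) → IsLyapunovStable (rhs m A₀ B d ω) x) ∧
      ((∃ j, (hurwitzDet L j).re < 0) → ¬ IsLyapunovStable (rhs m A₀ B d ω) x) := by
  obtain ⟨hstab, hunst, hker⟩ := routhHurwitz_matrix hL hD
  have hper := periodic_coeffMatrix m A₀ B hω.ne'
  set T := 2 * Real.pi / ω with hT
  have hTpos : 0 < T := by positivity
  have hTL : ∀ (z : ℂ) (w : Fin n → ℂ), (T • L) *ᵥ w = z • w →
      L *ᵥ w = ((T : ℂ)⁻¹ * z) • w := by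
    intro z w h
    rw [Matrix.smul_mulVec] at h
    have h2 : T⁻¹ • T • L *ᵥ w = T⁻¹ • z • w := by rw [h]
    rw [smul_smul, inv_mul_cancel₀ hTpos.ne', one_smul] at h2
    rw [h2, mul_smul, ← Complex.ofReal_inv, Complex.coe_smul]
  have h1 : ∀ v : Fin n → ℂ, Φ T *ᵥ v = v → v = 0 := by
    intro v hv
    by_contra hv0
    obtain ⟨z, hz, w, hw, hwz⟩ := exists_eigenvalue_of_exp (X := T • L) (μ := 1) hv0
      (by rw [hexp, hv, one_smul])
    -- `z ∈ 2πiℤ` has modulus less than `1`, hence is zero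
    have hz1 : ‖z‖ < 1 := by
      have hwpos : 0 < ‖w‖ := norm_pos_iff.2 hw
      have := Matrix.linfty_opNorm_mulVec (T • L) w
      rw [hwz, norm_smul] at this
      exact (le_of_mul_le_mul_right this hwpos).trans_lt hsmall
    obtain ⟨k, hk⟩ := Complex.exp_eq_one_iff.1 hz
    have hz0 : z = 0 := by
      rcases eq_or_ne k 0 with rfl | hk0
      · simpa using hk
      · exfalso
        have h2 : (1 : ℝ) ≤ |(k : ℝ)| := by exact_mod_cast Int.one_le_abs hk0
        rw [hk] at hz1
        simp only [norm_mul, Complex.norm_intCast, Complex.norm_I, mul_one, Complex.norm_real,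
          Complex.norm_ofNat, Real.norm_of_nonneg Real.pi_pos.le] at hz1
        nlinarith [Real.pi_gt_three]
    have := hTL z w hwz
    rw [hz0, mul_zero, zero_smul] at this
    exact hw (hker w this)
  obtain ⟨x, hx, hux⟩ := hΦ.existsUnique_periodic hper (continuous_forcing m d ω)
    (periodic_forcing m d hω.ne') h1
  simp only [IsPeriodicSolution, rhs_eq]
  refine ⟨x, hx, hux, fun hpos => ?_, fun hneg => ?_⟩
  · obtain ⟨C, hC⟩ := exists_norm_pow_le (M := Φ T) (fun μ v hv hμ => by
      rw [← hexp] at hμ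
      obtain ⟨z, hz, w, hw, hwz⟩ := exists_eigenvalue_of_exp hv hμ
      have := hstab hpos _ w hw (hTL z w hwz)
      rw [← hz, Complex.norm_exp, Real.exp_lt_one_iff]
      rw [← Complex.ofReal_inv, Complex.re_ofReal_mul] at this
      exact neg_of_mul_neg_right this (by positivity))
    exact hΦ.isLyapunovStable hper hTpos hK hC hx.1
  · obtain ⟨z, w, hw, hwz, hzre⟩ := hunst hneg
    refine hΦ.not_isLyapunovStable hper hTpos (μ := Complex.exp (T * z)) ?_ hw ?_ hx.1
    · rw [Complex.norm_exp, Real.one_lt_exp_iff, Complex.re_ofReal_mul]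
      positivity
    · rw [← hexp]
      apply exp_mulVec_of_eigenvector
      rw [Matrix.smul_mulVec, hwz, mul_smul, Complex.coe_smul]

/-- For large `ω` there is a unique periodic solution, and its stability is decided by the signs of
the leading coefficients of the Hurwitz determinants of the formal averaged system. -/
theorem eventually_stability [NeZero n] (hA₀ : ∀ i j, (A₀ i j).im = 0)
    (hB₀ : ∀ i j, (B 0 i j).im = 0)
    (hB : ∀ l : ℤ, 1 ≤ l → l ≤ m → B (-l) = (B l).map (starRingEnd ℂ))
    (hD : ∀ j : Fin n, hurwitzDet (avgMatrix m A₀ B) j ≠ 0) :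
    ∀ᶠ ω : ℝ in atTop, ∃ x : ℝ → Fin n → ℂ, IsPeriodicSolution m A₀ B d ω x ∧
      (∀ z, IsPeriodicSolution m A₀ B d ω z → z = x) ∧
      ((∀ j, 0 < firstCoeff (hurwitzDet (avgMatrix m A₀ B) j)) →
        IsLyapunovStable (rhs m A₀ B d ω) x) ∧
      ((∃ j, firstCoeff (hurwitzDet (avgMatrix m A₀ B) j) < 0) →
        ¬ IsLyapunovStable (rhs m A₀ B d ω) x) := by
  -- all leading coefficients are visible up to the order `N`
  set N := ∑ j, (hurwitzDet (avgMatrix m A₀ B) j).order.toNat + 1 with hN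
  have hNj : ∀ j, (hurwitzDet (avgMatrix m A₀ B) j).order.toNat < N := fun j =>
    Nat.lt_succ_of_le (Finset.single_le_sum
      (f := fun j => (hurwitzDet (avgMatrix m A₀ B) j).order.toNat) (fun _ _ => Nat.zero_le _)
      (Finset.mem_univ j))
  obtain ⟨K, hK, hKb⟩ := exists_norm_coeffMatrix_le m A₀ B
  obtain ⟨C, ω₀, hω₀, hlog⟩ := exists_real_log m A₀ B N hK hA₀ hB₀ hB
  have hfund : ∀ ω ≥ ω₀, ∃ Φ Ψ,
      IsFundamental (fun t => coeffMatrix m A₀ B (ω, ω * t)) K Φ Ψ := fun ω hω =>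
    exists_isFundamental (continuous_coeffMatrix m A₀ B ω) fun t => hKb ω (hω₀.trans hω) _
  choose! Φ Ψ hΦ using hfund
  have hlog' := fun ω hω => hlog ω hω (Φ ω) (Ψ ω) (hΦ ω hω)
  choose! L L₁ hexp hreal hsmall hchar hclose using hlog'
  have hExp : ∀ j, HasScalarExpansion N (fun ω => hurwitzDet (L₁ ω) j)
      (hurwitzDet (avgMatrix m A₀ B) j) :=
    HasScalarExpansion.hurwitzDet fun i j => hasScalarExpansion_entry m A₀ B hclose i j
  have hne : ∀ᶠ ω in atTop, ∀ j, hurwitzDet (L₁ ω) j ≠ 0 :=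
    eventually_all.2 fun j => (hExp j).eventually_ne_zero (hNj j) (hD j)
  have hpos : ∀ᶠ ω in atTop, ∀ j, 0 < firstCoeff (hurwitzDet (avgMatrix m A₀ B) j) →
      0 < (hurwitzDet (L₁ ω) j).re :=
    eventually_all.2 fun j => by
      by_cases h : 0 < firstCoeff (hurwitzDet (avgMatrix m A₀ B) j)
      · filter_upwards [(hExp j).eventually_re_pos (hNj j) h] with ω hω _ using hω
      · exact Eventually.of_forall fun _ h' => absurd h' h
  have hneg : ∀ᶠ ω in atTop, ∀ j, firstCoeff (hurwitzDet (avgMatrix m A₀ B) j) < 0 →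
      (hurwitzDet (L₁ ω) j).re < 0 :=
    eventually_all.2 fun j => by
      by_cases h : firstCoeff (hurwitzDet (avgMatrix m A₀ B) j) < 0
      · filter_upwards [(hExp j).eventually_re_neg (hNj j) h] with ω hω _ using hω
      · exact Eventually.of_forall fun _ h' => absurd h' h
  filter_upwards [hne, hpos, hneg, eventually_ge_atTop ω₀] with ω hne hpos hneg hω
  have hdet := fun j => hurwitzDet_congr (hchar ω hω) j
  obtain ⟨x, hx, hux, hs, hu⟩ := stability_of_log m A₀ B d (by linarith : 0 < ω) hK (hΦ ω hω)
    (hexp ω hω) (hreal ω hω) (hsmall ω hω) (fun j => by rw [hdet]; exact hne j)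
  exact ⟨x, hx, hux, fun h => hs fun j => by rw [hdet]; exact hpos j (h j),
    fun ⟨j, hj⟩ => hu ⟨j, by rw [hdet]; exact hneg j hj⟩⟩

end Final

end HighFreq

end

theorem mainTheorem2 (n m : ℕ)
    (A₀ : Matrix (Fin n) (Fin n) ℂ) (B : ℤ → Matrix (Fin n) (Fin n) ℂ) (d : ℤ → Fin n → ℂ)
    -- zero is an eigenvalue of `A₀`
    (hker : ∃ a : Fin n → ℂ, a ≠ 0 ∧ A₀ *ᵥ a = 0)
    -- no eigenvector with eigenvalue zero has a vector associated with respect to `A₀`, `A₁`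
    (hassoc : ∀ a : Fin n → ℂ, a ≠ 0 → A₀ *ᵥ a = 0 →
      ¬ ∃ x : Fin n → ℂ, A₀ *ᵥ x + HighFreq.matA₁ m B *ᵥ a = 0)
    -- the coefficient of `x` in the system is real
    (hA₀ : ∀ i j, (A₀ i j).im = 0)
    (hB₀ : ∀ i j, (B 0 i j).im = 0)
    (hB : ∀ l : ℤ, 1 ≤ l → l ≤ m → B (-l) = (B l).map (starRingEnd ℂ))
    -- no Hurwitz determinant of the formal averaged system vanishes identically
    (hD : ∀ j : Fin n, HighFreq.hurwitzDet (HighFreq.avgMatrix m A₀ B) j ≠ 0) :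
    ((∀ j : Fin n,
        0 < HighFreq.firstCoeff (HighFreq.hurwitzDet (HighFreq.avgMatrix m A₀ B) j)) →
      ∀ᶠ ω : ℝ in atTop, ∃ x : ℝ → Fin n → ℂ,
        HighFreq.IsPeriodicSolution m A₀ B d ω x ∧
        (∀ z, HighFreq.IsPeriodicSolution m A₀ B d ω z → z = x) ∧
        HighFreq.IsLyapunovStable (HighFreq.rhs m A₀ B d ω) x) ∧
    ((∃ j : Fin n,
        HighFreq.firstCoeff (HighFreq.hurwitzDet (HighFreq.avgMatrix m A₀ B) j) < 0) →
      ∀ᶠ ω : ℝ in atTop, ∃ x : ℝ → Fin n → ℂ,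
        HighFreq.IsPeriodicSolution m A₀ B d ω x ∧
        (∀ z, HighFreq.IsPeriodicSolution m A₀ B d ω z → z = x) ∧
        ¬ HighFreq.IsLyapunovStable (HighFreq.rhs m A₀ B d ω) x) := by
  obtain ⟨a, ha, -⟩ := hker
  have : NeZero n := ⟨by rintro rfl; exact ha (Subsingleton.elim _ _)⟩
  have h := HighFreq.eventually_stability m A₀ B d hA₀ hB₀ hB hD
  refine ⟨fun hpos => ?_, fun hneg => ?_⟩
  · filter_upwards [h] with ω ⟨x, hx, hux, hs, _⟩ using ⟨x, hx, hux, hs hpos⟩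
  · filter_upwards [h] with ω ⟨x, hx, hux, _, hu⟩ using ⟨x, hx, hux, hu hneg⟩
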